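/- Let $\Pi$ be a finitely generated abelian group, $\Pi_\natural\subset\Pi$ a subgroup, and let $\pi_\natural\subset\pi$ be their profinite completions. Let $p$ be a prime number. For a profinite abelian group $G$ write $G^{(p)}$ for its pro-$p$ completion and $G^{(p)}_{\mathbb{Q}_p}=G^{(p)}\otimes_{\mathbb{Z}_p}\mathbb{Q}_p$. Let $\sigma:\pi\to\pi$ be a continuous automorphism, and let $\alpha\in\mathbb{Z}_p^\times$ be an element which is not a root of unity, such that $\sigma$ induces a semi-simple $\mathbb{Q}_p$-linear map on $\pi^{(p)}_{\mathbb{Q}_p}$ which stabilizes $\pi^{(p)}_{\natural,\mathbb{Q}_p}$, is multiplication by $\alpha^{-2}$ on $\pi^{(p)}_{\natural,\mathbb{Q}_p}$, and induces multiplication by $\alpha^{-1}$ on $(\pi/\pi_\natural)^{(p)}_{\mathbb{Q}_p}$. Let $\mathrm{Char}^\Pi_{\overline{\mathbb{Q}}_p}=\mathrm{Spec}(\overline{\mathbb{Q}}_p[\Pi])$. Let $\mathrm{Hom}_{\mathrm{cont}}(\pi,\overline{\mathbb{Q}}_p^\times)$ be the set of characters of $\pi$ that are continuous with values in $E^\times$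 for some finite extension $E$ of $\mathbb{Q}_p$ inside $\overline{\mathbb{Q}}_p$, and let $\varphi:\mathrm{Hom}_{\mathrm{cont}}(\pi,\overline{\mathbb{Q}}_p^\times)\to\mathrm{Char}^\Pi_{\overline{\mathbb{Q}}_p}$ be the map sending $\chi$ to the closed point defined by the restriction of $\chi$ along $\Pi\to\pi$. A torsion point of $\mathrm{Char}^\Pi_{\overline{\mathbb{Q}}_p}$ is a closed point defined by a character $\Pi\to\overline{\mathbb{Q}}_p^\times$ of finite order. Let $S\subset\mathrm{Char}^\Pi_{\overline{\mathbb{Q}}_p}$ be a Zariski closed subset such that $\varphi^{-1}(S)$ is stabilized by $\sigma$, i.e. $\chi\circ\sigma\in\varphi^{-1}(S)$ for every $\chi\in\varphi^{-1}(S)$. Then for every irreducible component $S'$ of $S$ with $\varphi^{-1}(S')$ non-empty, the torsion points lying on $S'$ are Zariski dense in $S'$. -/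

import Mathlib

open scoped TensorProduct

universe u

noncomputable section

/-! ### The profinite completion of an abelian group -/

/-- The profinite completion `π` of an abelian group `Γ`, i.e. Mathlib's limit of the finite
quotients of `Γ`, viewed as a topological abelian group. -/
def ProfComp (Γ : Type u) [CommGroup Γ] : Type u :=
  ProfiniteGrp.ProfiniteCompletion.completion (GrpCat.of Γ)

namespace ProfComp

variable (Γ : Type u) [CommGroup Γ]

instance : CommGroup (ProfComp Γ) :=
  { (inferInstance : Group (ProfiniteGrp.ProfiniteCompletion.completion (GrpCat.of Γ))) with
    mul_comm := by
      intro a b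
      apply ProfiniteGrp.limit_ext
      intro j
      change a.1 j * b.1 j = b.1 j * a.1 j
      obtain ⟨x, hx⟩ := QuotientGroup.mk_surjective (a.1 j)
      obtain ⟨y, hy⟩ := QuotientGroup.mk_surjective (b.1 j)
      rw [← hx, ← hy]
      exact congrArg (QuotientGroup.mk (s := j.toSubgroup)) (mul_comm x y) }

instance : TopologicalSpace (ProfComp Γ) :=
  inferInstanceAs (TopologicalSpace
    (ProfiniteGrp.ProfiniteCompletion.completion (GrpCat.of Γ)))

instance : IsTopologicalGroup (ProfComp Γ) :=
  inferInstanceAs (IsTopologicalGroup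
    (ProfiniteGrp.ProfiniteCompletion.completion (GrpCat.of Γ)))

/-- The canonical homomorphism `Γ → π`. -/
def eta : Γ →* ProfComp Γ :=
  (ProfiniteGrp.ProfiniteCompletion.eta (GrpCat.of Γ)).hom

variable {Γ}

/-- The continuous homomorphism of profinite completions induced by a group homomorphism. -/
def map {Δ : Type u} [CommGroup Δ] (f : Δ →* Γ) : ProfComp Δ →ₜ* ProfComp Γ :=
  (ProfiniteGrp.profiniteCompletion.map (GrpCat.ofHom f)).hom

end ProfComp

/-! ### The pro-`p` completion of a topological abelian group and its rationalization -/

section ProP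

variable (p : ℕ) [Fact p.Prime]

/-- The open subgroups of `p`-power index of a topological group. -/
def OpenPSubgroup (G : Type u) [CommGroup G] [TopologicalSpace G] : Type u :=
  {U : Subgroup G // IsOpen (U : Set G) ∧ ∃ k : ℕ, U.index = p ^ k}

variable {p} {G : Type u} [CommGroup G] [TopologicalSpace G]

namespace OpenPSubgroup

/-- The finite `p`-group `G / U`, written additively. -/
abbrev Quot (U : OpenPSubgroup p G) : Type u := Additive (G ⧸ U.1)

/-- The exponent `k` such that `U` has index `p ^ k`. -/
def exponent (U : OpenPSubgroup p G) : ℕ := U.2.2.choose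

theorem index_eq (U : OpenPSubgroup p G) : U.1.index = p ^ U.exponent := U.2.2.choose_spec

theorem pow_exponent_nsmul (U : OpenPSubgroup p G) (a : U.Quot) :
    (p ^ U.exponent) • a = 0 := by
  rw [← U.index_eq]
  exact pow_card_eq_one' (G := G ⧸ U.1) (x := a.toMul)

/-- `ℤ_p` acts on `G / U`, which is killed by `p ^ k`, through `ℤ_p → ℤ / p ^ k`. -/
instance (U : OpenPSubgroup p G) : Module ℤ_[p] U.Quot :=
  letI : Module (ZMod (p ^ U.exponent)) U.Quot := AddCommGroup.zmodModule U.pow_exponent_nsmul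
  Module.compHom U.Quot (PadicInt.toZModPow (p := p) U.exponent)

theorem smul_eq_appr_nsmul (U : OpenPSubgroup p G) (x : ℤ_[p]) (n : ℕ) (hn : U.exponent ≤ n)
    (a : U.Quot) : x • a = (x.appr n) • a := by
  let _ : Module (ZMod (p ^ U.exponent)) U.Quot := AddCommGroup.zmodModule U.pow_exponent_nsmul
  have h1 : x • a = (PadicInt.toZModPow (p := p) U.exponent x) • a := rfl
  have h2 : PadicInt.toZModPow (p := p) U.exponent x
      = ((x.appr n : ℕ) : ZMod (p ^ U.exponent)) := by
    have := PadicInt.cast_toZModPow (p := p) U.exponent n hn x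
    rw [← this]
    change ((((x.appr n : ℕ) : ZMod (p ^ n))).cast : ZMod (p ^ U.exponent)) = _
    exact ZMod.cast_natCast (pow_dvd_pow p hn) _
  rw [h1, h2, Nat.cast_smul_eq_nsmul]

/-- A homomorphism between such quotients (for possibly different groups) is `ℤ_p`-linear. -/
def toLinear {H : Type u} [CommGroup H] [TopologicalSpace H] {U : OpenPSubgroup p G}
    {V : OpenPSubgroup p H} (f : (G ⧸ U.1) →* (H ⧸ V.1)) : U.Quot →ₗ[ℤ_[p]] V.Quot where
  toFun := f.toAdditive
  map_add' := f.toAdditive.map_add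
  map_smul' x a := by
    rw [RingHom.id_apply,
      U.smul_eq_appr_nsmul x _ (le_max_left U.exponent V.exponent) a,
      V.smul_eq_appr_nsmul x _ (le_max_right U.exponent V.exponent), map_nsmul]

/-- The preimage of an open subgroup of `p`-power index under a continuous homomorphism. -/
def comap {H : Type u} [CommGroup H] [TopologicalSpace H] (f : G →ₜ* H)
    (V : OpenPSubgroup p H) : OpenPSubgroup p G :=
  ⟨V.1.comap f.toMonoidHom, V.2.1.preimage f.continuous_toFun, by
    have h : (V.1.comap f.toMonoidHom).index ∣ p ^ V.exponent := by
      rw [Subgroup.index_comap, ← V.index_eq]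
      exact Subgroup.relIndex_dvd_index_of_normal _ _
    obtain ⟨k, -, hk⟩ := (Nat.dvd_prime_pow Fact.out).1 h
    exact ⟨k, hk⟩⟩

end OpenPSubgroup

variable (p G) in
/-- The pro-`p` completion of `G`, written additively, with its `ℤ_p`-module structure: the
inverse limit of the quotients `G / U` over the open subgroups `U` of `p`-power index. -/
def ProPCompletion : Submodule ℤ_[p] (∀ U : OpenPSubgroup p G, U.Quot) where
  carrier := {x | ∀ (U V : OpenPSubgroup p G) (h : U.1 ≤ V.1),
    OpenPSubgroup.toLinear (QuotientGroup.map U.1 V.1 (MonoidHom.id G) h) (x U) = x V}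
  add_mem' {x y} hx hy U V h := by
    rw [Pi.add_apply, map_add, hx U V h, hy U V h, Pi.add_apply]
  zero_mem' U V h := by rw [Pi.zero_apply, map_zero, Pi.zero_apply]
  smul_mem' c x hx U V h := by
    rw [Pi.smul_apply, map_smul, hx U V h, Pi.smul_apply]

variable (p) in
/-- The `ℤ_p`-linear map on pro-`p` completions induced by a continuous homomorphism `f`; its
component at `V` is induced by `G / f⁻¹ V → H / V`. -/
def ProPCompletion.map {H : Type u} [CommGroup H] [TopologicalSpace H] (f : G →ₜ* H) :
    ProPCompletion p G →ₗ[ℤ_[p]] ProPCompletion p H :=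
  LinearMap.codRestrict _
    ((LinearMap.pi fun V : OpenPSubgroup p H =>
      (OpenPSubgroup.toLinear (U := OpenPSubgroup.comap f V) (V := V)
        (QuotientGroup.map (OpenPSubgroup.comap f V).1 V.1 f.toMonoidHom le_rfl)).comp
        (LinearMap.proj (OpenPSubgroup.comap f V))).comp (ProPCompletion p G).subtype) (by
    rintro ⟨x, hx⟩ V W h
    have h' : (OpenPSubgroup.comap f V).1 ≤ (OpenPSubgroup.comap f W).1 := fun g hg => h hg
    have hxVW := hx _ _ h'
    simp only [LinearMap.comp_apply, LinearMap.pi_apply, LinearMap.proj_apply,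
      Submodule.subtype_apply]
    rw [← hxVW]
    generalize x (OpenPSubgroup.comap f V) = a
    obtain ⟨g, hg⟩ := QuotientGroup.mk_surjective a.toMul
    rw [show a = Additive.ofMul (QuotientGroup.mk g) from hg.symm]
    rfl)

variable (p G) in
/-- `G^{(p)} ⊗_{ℤ_p} ℚ_p`, where `G^{(p)}` is the pro-`p` completion of `G`. -/
abbrev RatProP : Type u := ℚ_[p] ⊗[ℤ_[p]] (ProPCompletion p G)

variable (p) in
/-- The `ℚ_p`-linear map induced by a continuous homomorphism. -/
def RatProP.map {H : Type u} [CommGroup H] [TopologicalSpace H] (f : G →ₜ* H) :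
    RatProP p G →ₗ[ℚ_[p]] RatProP p H :=
  (ProPCompletion.map p f).baseChange ℚ_[p]

end ProP

/-! ### The automorphism `σ` -/

section Weights

variable {Γ : Type u} [CommGroup Γ]

/-- The profinite completion of the subgroup `N ≤ Γ` as a subgroup of that of `Γ`. -/
def naturalSubgroup (N : Subgroup Γ) : Subgroup (ProfComp Γ) :=
  (ProfComp.map N.subtype).toMonoidHom.range

/-- The continuous projection `π → π / π_♮`. -/
def naturalQuotient (N : Subgroup Γ) : ProfComp Γ →ₜ* (ProfComp Γ ⧸ naturalSubgroup N) :=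
  { QuotientGroup.mk' (naturalSubgroup N) with
    continuous_toFun := continuous_quot_mk }

/-- `σ` acts on `π^{(p)}_{ℚ_p}` semi-simply, stabilizing `π_{♮,ℚ_p}^{(p)}`, with multiplication
by `α⁻²` on `π_{♮,ℚ_p}^{(p)}` and by `α⁻¹` on `(π / π_♮)^{(p)}_{ℚ_p}`; and `α` is not a root of
unity. -/
structure ActsWithWeights (p : ℕ) [Fact p.Prime] (N : Subgroup Γ)
    (σ : ProfComp Γ ≃ₜ* ProfComp Γ) (α : ℤ_[p]ˣ) : Prop where
  not_root_of_unity : ∀ n : ℕ, 0 < n → α ^ n ≠ 1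
  semisimple : Module.End.IsSemisimple
    (RatProP.map p (σ : ProfComp Γ →ₜ* ProfComp Γ) : Module.End ℚ_[p] (RatProP p (ProfComp Γ)))
  weight_two : ∀ v : RatProP p (ProfComp N),
    RatProP.map p (σ : ProfComp Γ →ₜ* ProfComp Γ) (RatProP.map p (ProfComp.map N.subtype) v) =
      (((α ^ (-2 : ℤ) : ℤ_[p]ˣ) : ℤ_[p]) : ℚ_[p]) • RatProP.map p (ProfComp.map N.subtype) v
  weight_one : ∀ v : RatProP p (ProfComp Γ),
    RatProP.map p (naturalQuotient N) (RatProP.map p (σ : ProfComp Γ →ₜ* ProfComp Γ) v) =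
      (((α ^ (-1 : ℤ) : ℤ_[p]ˣ) : ℤ_[p]) : ℚ_[p]) • RatProP.map p (naturalQuotient N) v

end Weights

/-! ### The character variety and continuous characters -/

section Char

variable (p : ℕ) [Fact p.Prime] (Γ : Type u) [CommGroup Γ]

/-- The underlying space of the character variety `Spec (K[Γ])` over a field `K`. -/
abbrev CharVariety (K : Type) [Field K] : Type u := PrimeSpectrum (MonoidAlgebra K Γ)

variable {Γ} in
/-- The closed point of the character variety given by a character `ψ : Γ → Kˣ`: the kernel of
the induced `K`-algebra homomorphism `K[Γ] → K`. -/
def charPoint {K : Type} [Field K] (ψ : Γ →* Kˣ) : CharVariety Γ K :=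
  ⟨RingHom.ker (MonoidAlgebra.lift K K Γ ((Units.coeHom K).comp ψ)), RingHom.ker_isPrime _⟩

/-- The torsion points of the character variety: the points of the characters of finite order. -/
def torsionPoints (K : Type) [Field K] : Set (CharVariety Γ K) :=
  {x | ∃ ψ : Γ →* Kˣ, IsOfFinOrder ψ ∧ charPoint ψ = x}

/-- The set `Hom_cont(π, ℚ̄_pˣ)`, the colimit of `Hom_cont(π, Eˣ)` over the finite extensions
`E` of `ℚ_p` inside `ℚ̄_p`. -/
structure ContChar where
  toHom : ProfComp Γ →* (PadicAlgCl p)ˣ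
  continuous_toHom : Continuous toHom
  exists_finite : ∃ E : IntermediateField ℚ_[p] (PadicAlgCl p),
    FiniteDimensional ℚ_[p] E ∧ ∀ g, (toHom g : PadicAlgCl p) ∈ E

variable {p Γ}

/-- The action of an automorphism `σ` of `π` on continuous characters, `χ ↦ χ ∘ σ`. -/
def ContChar.act (σ : ProfComp Γ ≃ₜ* ProfComp Γ) (χ : ContChar p Γ) : ContChar p Γ where
  toHom := χ.toHom.comp (σ : ProfComp Γ →* ProfComp Γ)
  continuous_toHom := χ.continuous_toHom.comp σ.continuous_toFun
  exists_finite := by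
    obtain ⟨E, hE, h⟩ := χ.exists_finite
    exact ⟨E, hE, fun g => h (σ g)⟩

/-- The map `φ` from continuous characters of `π` to points of the character variety of `Γ`,
induced by restriction along `Γ → π`. -/
def phi (χ : ContChar p Γ) : CharVariety Γ (PadicAlgCl p) :=
  charPoint (χ.toHom.comp (ProfComp.eta Γ))

end Char

end

/-!
The closed set `S` is a union of components, and the torsion points of one of them, `S'`, are
dense for the following reason: through a Zariski dense set of points of `S'` there is a coset of
a subtorus which is contained in `S'` and in which the torsion points are dense.

*The points.* The continuous characters are the characters of `Γ` with values of norm `1`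
(`exists_contChar`). They are Zariski dense in `S'` as soon as there is one
(`exists_contChar_notMem`). Indeed `S'` has a model of finite type over `ℤ_[p]` with a point in
the special fibre; a suitable closed subdomain through that point avoids a given proper closed
subset and is isolated in its fibre over `p`. By Zariski's Main Theorem, and because `ℤ_[p]` is
Henselian, this subdomain is integral over `ℤ_[p]`; its embeddings into `PadicAlgCl p` are
characters with integral values (`PadicAlgCl.exists_integral_point`).

*The cosets.* Let `χ` be a continuous character in `S`. Its `p`-adic logarithm is a continuous
homomorphism from `π` to `ℂ_[p]`, so it inherits the relation `(σ - α⁻¹) (σ - α⁻²) = 0` of the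
rationalized pro-`p` completion (`ActsWithWeights.quadratic_relation`). As `α⁻¹ ≠ α⁻²`, the
logarithm is a sum `x + y` of components of weights one and two. For a suitable `n > 0` and
`u = α ^ (-n k) - 1`, the character `χ ∘ σ ^ (n k)` is then `χ · exp (u x + (u² + 2 u) y)`
(`ActsWithWeights.exists_weights`). An element of the ideal of `S` vanishes at all these
characters, and `u` accumulates at `0` as `α` is not a root of unity. Exponentials of distinct
polynomials `u x + (u² + 2 u) y` are linearly independent
(`eq_zero_of_frequently_sum_exp_weightPoly`); hence such an element vanishes on all characters
that differ from `χ` by one that factors through `w = (x, y)` (`ActsWithWeights.exists_coset`).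

*The torsion points.* The logarithm of `χ` vanishes on the kernel of `w`, where the values of `χ`
are thus roots of unity. Hence the coset contains a torsion point, and its torsion points are
dense by Dedekind's independence of characters (`exists_torsion_evalChar_ne_zero`).

It remains to choose `χ` outside the other components of `S`: the coset is irreducible, so it is
contained in some component, which has to be `S'`.
-/

/-! ### Isolating a closed point in its fibre -/

/-- If `x` lies in every nonzero prime contained in `m`, then `m` is minimal over `(x)`. Otherwise
prime avoidance gives `y ∈ m` outside all minimal primes of `(x)`; a minimal prime of `(y)` inside
`m` then strictly contains a minimal prime of `(x)`, against Krull's principal ideal theorem. -/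
lemma Ideal.mem_minimalPrimes_span_singleton_of_forall_mem {D : Type*} [CommRing D] [IsDomain D]
    [IsNoetherianRing D] (m : Ideal D) [m.IsPrime] {x : D} (hx0 : x ≠ 0) (hxm : x ∈ m)
    (H : ∀ Q : Ideal D, Q.IsPrime → Q ≠ ⊥ → Q ≤ m → x ∈ Q) :
    m ∈ (Ideal.span {x}).minimalPrimes := by
  by_contra hm
  have hspan : Ideal.span {x} ≤ m := by simpa [Ideal.span_le] using hxm
  have hfin := Ideal.finite_minimalPrimes_of_isNoetherianRing D (Ideal.span {x})
  have hnot : ¬ ((m : Set D) ⊆ ⋃ Q ∈ (Ideal.span {x}).minimalPrimes, (Q : Set D)) := by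
    intro hsub
    obtain ⟨Q, hQ, hmQ⟩ := (Ideal.subset_union_prime_finite hfin (f := id) 0 0
      (fun Q hQ _ _ => hQ.1.1)).1 hsub
    have : Q = m := le_antisymm (hQ.2 ⟨inferInstance, hspan⟩ hmQ) hmQ
    exact hm (this ▸ hQ)
  obtain ⟨y, hym, hy⟩ := Set.not_subset.1 hnot
  simp only [Set.mem_iUnion, not_exists] at hy
  obtain ⟨Q₀, hQ₀, -⟩ := Ideal.exists_minimalPrimes_le hspan
  have hy0 : y ≠ 0 := fun h => hy Q₀ hQ₀ (h ▸ Q₀.zero_mem)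
  obtain ⟨Q₂, hQ₂, hQ₂m⟩ := Ideal.exists_minimalPrimes_le
    (show Ideal.span {y} ≤ m by simpa [Ideal.span_le] using hym)
  have hyQ₂ : y ∈ Q₂ := hQ₂.1.2 (Ideal.mem_span_singleton_self y)
  have : Q₂.IsPrime := hQ₂.1.1
  have hxQ₂ : x ∈ Q₂ := H Q₂ hQ₂.1.1 (fun h => hy0 (by simpa [h] using hyQ₂)) hQ₂m
  obtain ⟨Q₁, hQ₁, hQ₁₂⟩ := Ideal.exists_minimalPrimes_le
    (show Ideal.span {x} ≤ Q₂ by simpa [Ideal.span_le] using hxQ₂)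
  have : Q₁.IsPrime := hQ₁.1.1
  have hlt : Q₁ < Q₂ := lt_of_le_of_ne hQ₁₂ (fun h => hy Q₁ hQ₁ (h ▸ hyQ₂))
  have hlt' : (⊥ : Ideal D) < Q₁ := by
    refine bot_lt_iff_ne_bot.2 fun h => hx0 ?_
    simpa [h] using hQ₁.1.2 (Ideal.mem_span_singleton_self x)
  have h1 := Ideal.height_le_one_of_isPrincipal_of_mem_minimalPrimes (Ideal.span {y}) Q₂ hQ₂
  have h2 := Ideal.height_strict_mono_of_isPrime_of_isPrime hlt
  have h3 := Ideal.height_strict_mono_of_isPrime_of_isPrime hlt'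
  have h4 := lt_of_lt_of_le h2 h1
  rw [Order.lt_one_iff] at h4
  simp [h4] at h3

/-- A maximal ideal `m` over `(ϖ)` becomes isolated in its fibre over `R` after passing to a
quotient domain in which `ϖ g` stays nonzero, so that Zariski's Main Theorem applies to it there. -/
lemma exists_isPrime_zariskisMainProperty {R B : Type*} [CommRing R] [CommRing B] [IsDomain B]
    [Algebra R B] [IsNoetherianRing R] [Algebra.FiniteType R B] (m : Ideal B) [m.IsMaximal]
    (ϖ : R) (hϖ : (Ideal.span {ϖ}).IsMaximal) (hϖm : algebraMap R B ϖ ∈ m)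
    (g : B) (hg : algebraMap R B ϖ * g ≠ 0) :
    ∃ q : Ideal B, q.IsPrime ∧ algebraMap R B ϖ * g ∉ q ∧ q ≤ m ∧
      Algebra.ZariskisMainProperty R (m.map (Ideal.Quotient.mk q)) := by
  have : IsNoetherianRing B := Algebra.FiniteType.isNoetherianRing R B
  set x := algebraMap R B ϖ * g with hx
  -- Take `q` maximal among the primes inside `m` that avoid `x`. Every nonzero prime of `B / q`
  -- inside the image of `m` then contains `x`, so this image is minimal over `(x)`.
  obtain ⟨q, ⟨hqp, hqm, hxq⟩, hmax⟩ := (set_has_maximal_iff_noetherian.2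
    (inferInstance : IsNoetherian B B)) {q : Ideal B | q.IsPrime ∧ q ≤ m ∧ x ∉ q}
    ⟨⊥, Ideal.isPrime_bot, bot_le, by simpa using hg⟩
  refine ⟨q, hqp, hxq, hqm, ?_⟩
  let D := B ⧸ q
  let m' : Ideal D := m.map (Ideal.Quotient.mk q)
  have hcomap : m'.comap (Ideal.Quotient.mk q) = m := Ideal.comap_map_mk hqm
  have hm'max : m'.IsMaximal := by
    refine (Ideal.map_eq_top_or_isMaximal_of_surjective _ Ideal.Quotient.mk_surjective
      inferInstance).resolve_left fun h => Ideal.IsPrime.ne_top (I := m) inferInstance ?_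
    rw [← hcomap, show m' = ⊤ from h, Ideal.comap_top]
  have hmin : m' ∈ (Ideal.span {Ideal.Quotient.mk q x}).minimalPrimes := by
    refine Ideal.mem_minimalPrimes_span_singleton_of_forall_mem m' ?_ ?_ ?_
    · rwa [Ne, Ideal.Quotient.eq_zero_iff_mem]
    · exact Ideal.mem_map_of_mem _ (m.mul_mem_right _ hϖm)
    · intro Q hQ hQ0 hQm
      by_contra hxQ
      refine hmax (Q.comap (Ideal.Quotient.mk q)) ⟨inferInstance, ?_, hxQ⟩ ?_
      · rw [← hcomap]
        exact Ideal.comap_mono hQm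
      · refine lt_of_le_of_ne (fun a ha => ?_) fun h => hQ0 ?_
        · rw [Ideal.mem_comap, Ideal.Quotient.eq_zero_iff_mem.2 ha]
          exact Q.zero_mem
        · rw [← Ideal.map_comap_of_surjective _ Ideal.Quotient.mk_surjective Q, ← h,
            Ideal.map_quotient_self]
  have hϖm' : algebraMap R D ϖ ∈ m' := Ideal.mem_map_of_mem (Ideal.Quotient.mk q) hϖm
  have hund : m'.under R = Ideal.span {ϖ} := by
    refine (hϖ.eq_of_le (Ideal.IsPrime.ne_top inferInstance) ?_).symm
    rwa [Ideal.span_singleton_le_iff_mem]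
  have : Algebra.WeaklyQuasiFiniteAt R m' := by
    have hmax' : (m'.under R).IsMaximal := hund ▸ hϖ
    let := Ideal.Quotient.field (m'.under R)
    have hart : IsArtinianRing (R ⧸ m'.under R) := inferInstance
    have hqf : Algebra.QuasiFinite R (R ⧸ m'.under R) := inferInstance
    unfold Algebra.WeaklyQuasiFiniteAt
    set J := (m'.under R).map (algebraMap R D)
    have hop : Algebra.QuasiFiniteAt (R ⧸ m'.under R) (m'.map (Ideal.Quotient.mk J)) := by
      have hJ : J ≤ m' := Ideal.map_comap_le
      have hmJ : (m'.map (Ideal.Quotient.mk J)).IsPrime := inferInstance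
      have hcomapJ : (m'.map (Ideal.Quotient.mk J)).comap (Ideal.Quotient.mk J) = m' :=
        Ideal.comap_map_mk hJ
      have hmJmax : (m'.map (Ideal.Quotient.mk J)).IsMaximal := by
        refine (Ideal.map_eq_top_or_isMaximal_of_surjective _ Ideal.Quotient.mk_surjective
          inferInstance).resolve_left hmJ.ne_top
      have hft : Algebra.FiniteType (R ⧸ m'.under R) (D ⧸ J) :=
        Algebra.FiniteType.of_restrictScalars_finiteType R _ _
      have : IsNoetherianRing (D ⧸ J) := inferInstance
      have : IsJacobsonRing (D ⧸ J) := isJacobsonRing_of_finiteType (A := R ⧸ m'.under R)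
      refine Algebra.QuasiFiniteAt.of_isOpen_singleton (R := R ⧸ m'.under R)
        (⟨m'.map (Ideal.Quotient.mk J), hmJ⟩ : PrimeSpectrum (D ⧸ J)) ?_
      generalize hz : (⟨m'.map (Ideal.Quotient.mk J), hmJ⟩ : PrimeSpectrum (D ⧸ J)) = z
      have hz' : z.asIdeal = m'.map (Ideal.Quotient.mk J) := by rw [← hz]
      have htfae : IsOpen {z} ↔ IsClosed {z} ∧ StableUnderGeneralization {z} :=
        (PrimeSpectrum.isOpen_singleton_tfae_of_isNoetherian_of_isJacobsonRing z).out 0 2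
      -- In the fibre over `(ϖ)` the point `m` is closed, as `m` is maximal, and it has no proper
      -- generalization, as such a prime would contain `ϖ`, hence `x`, and be smaller than `m`.
      refine htfae.2 ⟨(PrimeSpectrum.isClosed_singleton_iff_isMaximal _).2 (hz' ▸ hmJmax), ?_⟩
      intro a b hab h
      rw [Set.mem_singleton_iff] at h ⊢
      subst h
      rw [← PrimeSpectrum.le_iff_specializes, ← PrimeSpectrum.asIdeal_le_asIdeal, hz'] at hab
      refine PrimeSpectrum.ext (le_antisymm (hz' ▸ hab) ?_)
      have hle : b.asIdeal.comap (Ideal.Quotient.mk J) ≤ m' := by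
        rw [← hcomapJ]
        exact Ideal.comap_mono hab
      have hmem : Ideal.Quotient.mk q x ∈ b.asIdeal.comap (Ideal.Quotient.mk J) := by
        have h1 : Ideal.Quotient.mk J (algebraMap R D ϖ) = 0 :=
          Ideal.Quotient.eq_zero_iff_mem.2 (Ideal.mem_map_of_mem _ hϖm')
        have h2 : Ideal.Quotient.mk q x = algebraMap R D ϖ * Ideal.Quotient.mk q g := by
          rw [hx, map_mul]; rfl
        rw [Ideal.mem_comap, h2, map_mul, h1, zero_mul]
        exact b.asIdeal.zero_mem
      have := hmin.2 ⟨inferInstance, (Ideal.span_singleton_le_iff_mem _).2 hmem⟩ hle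
      rw [hz']
      exact Ideal.map_le_iff_le_comap.2 this
    exact Algebra.QuasiFinite.trans R (R ⧸ m'.under R) _
  exact Algebra.ZariskisMainProperty.of_finiteType_of_weaklyQuasiFiniteAt m'

/-! ### Henselianity of the `p`-adic integers -/

lemma RingHom.injective_of_injective_comp_algebraMap {R A C : Type*} [CommRing R] [CommRing A]
    [IsDomain A] [Algebra R A] [Algebra.IsAlgebraic R A] [CommRing C] (f : A →+* C)
    (h : Function.Injective (f.comp (algebraMap R A))) : Function.Injective f := by
  rw [injective_iff_map_eq_zero]
  intro a ha
  by_contra hne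
  obtain ⟨r, hr0, b, hb⟩ := (Algebra.IsAlgebraic.isAlgebraic (R := R) a).exists_nonzero_dvd
    (mem_nonZeroDivisors_of_ne_zero hne)
  refine hr0 (h ?_)
  rw [RingHom.comp_apply, hb, map_mul, ha, zero_mul, map_zero]

namespace PadicAlgCl

variable {p : ℕ} [Fact p.Prime]

lemma norm_le_one_iff_isIntegral {x : PadicAlgCl p} : ‖x‖ ≤ 1 ↔ IsIntegral ℤ_[p] x := by
  have hx : IsIntegral ℚ_[p] x := Algebra.IsIntegral.isIntegral x
  have key : ‖x‖ ≤ 1 ↔ ∀ n, ‖(minpoly ℚ_[p] x).coeff n‖ ≤ 1 :=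
    spectralValue_le_one_iff (minpoly.monic hx)
  rw [key]
  constructor
  · intro h
    have hlift : minpoly ℚ_[p] x ∈ Polynomial.lifts (algebraMap ℤ_[p] ℚ_[p]) := by
      rw [Polynomial.lifts_iff_coeff_lifts]
      exact fun n => ⟨⟨_, h n⟩, rfl⟩
    obtain ⟨q, hq, -, hqm⟩ := Polynomial.lifts_and_natDegree_eq_and_monic hlift (minpoly.monic hx)
    refine ⟨q, hqm, ?_⟩
    have := minpoly.aeval ℚ_[p] x
    rw [← hq, Polynomial.aeval_map_algebraMap] at this
    exact this
  · intro h n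
    rw [minpoly.isIntegrallyClosed_eq_field_fractions' ℚ_[p] h, Polynomial.coeff_map]
    exact PadicInt.norm_le_one _

instance : FaithfulSMul ℤ_[p] (PadicAlgCl p) := by
  rw [faithfulSMul_iff_algebraMap_injective,
    IsScalarTower.algebraMap_eq ℤ_[p] ℚ_[p] (PadicAlgCl p)]
  exact (algebraMap ℚ_[p] (PadicAlgCl p)).injective.comp (IsFractionRing.injective ℤ_[p] ℚ_[p])

instance : Module.IsTorsionFree ℤ_[p] (PadicAlgCl p) :=
  Module.isTorsionFree_iff_faithfulSMul.2 inferInstance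

/-- The integers of `PadicAlgCl p` are the elements of norm at most `1`, so the nonunits are those
of norm less than `1`. -/
instance : IsLocalRing (integralClosure ℤ_[p] (PadicAlgCl p)) := by
  have hunit : ∀ a : integralClosure ℤ_[p] (PadicAlgCl p), ‖(a : PadicAlgCl p)‖ = 1 → IsUnit a := by
    intro a ha
    have ha0 : (a : PadicAlgCl p) ≠ 0 := by
      intro h; simp [h] at ha
    refine IsUnit.of_mul_eq_one ⟨(a : PadicAlgCl p)⁻¹, norm_le_one_iff_isIntegral.1 ?_⟩ ?_
    · rw [norm_inv, ha, inv_one]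
    · exact Subtype.ext (mul_inv_cancel₀ ha0)
  refine IsLocalRing.of_isUnit_or_isUnit_one_sub_self fun a => ?_
  have ha : ‖(a : PadicAlgCl p)‖ ≤ 1 := norm_le_one_iff_isIntegral.2 a.2
  rcases ha.eq_or_lt with h | h
  · exact .inl (hunit a h)
  · refine .inr (hunit _ ?_)
    have := IsUltrametricDist.norm_add_eq_max_of_norm_ne_norm (x := (1 : PadicAlgCl p))
      (y := -(a : PadicAlgCl p)) (by rw [norm_neg, norm_one]; exact h.ne')
    rw [← sub_eq_add_neg, norm_neg, norm_one, max_eq_left ha] at this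
    exact this

end PadicAlgCl

section

variable {p : ℕ} [Fact p.Prime]

/-- This is where the Henselian property of `ℤ_[p]` enters: the norm of `ℚ_[p]` extends to its
algebraic closure, so the integral closure of `ℤ_[p]` there is local. -/
lemma PadicInt.isLocalRing_of_isIntegral (A : Type*) [CommRing A] [IsDomain A] [Algebra ℤ_[p] A]
    [FaithfulSMul ℤ_[p] A] [Algebra.IsIntegral ℤ_[p] A] : IsLocalRing A := by
  let f : A →ₐ[ℤ_[p]] PadicAlgCl p := IsAlgClosed.lift
  have hf : Function.Injective f := by
    refine RingHom.injective_of_injective_comp_algebraMap (R := ℤ_[p]) f.toRingHom ?_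
    have h : f.toRingHom.comp (algebraMap ℤ_[p] A) = algebraMap ℤ_[p] (PadicAlgCl p) :=
      f.comp_algebraMap
    rw [h]
    exact FaithfulSMul.algebraMap_injective _ _
  let g : A →ₐ[ℤ_[p]] integralClosure ℤ_[p] (PadicAlgCl p) :=
    f.codRestrict _ fun a => (Algebra.IsIntegral.isIntegral a).map f
  have hg : Function.Injective g := fun a b h => hf (congrArg Subtype.val h)
  have hgi : g.toRingHom.IsIntegral := by
    intro x
    obtain ⟨q, hq, hq0⟩ := Algebra.IsIntegral.isIntegral (R := ℤ_[p]) x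
    refine ⟨q.map (algebraMap ℤ_[p] A), hq.map _, ?_⟩
    rw [Polynomial.eval₂_map, ← hq0]
    congr 1
    exact g.comp_algebraMap
  have := hgi.isLocalHom hg
  exact RingHom.domain_isLocalRing g.toRingHom

/-- The conclusion of Zariski's Main Theorem at a prime over `p` says that `D` becomes integral
after inverting some `r ∉ m` integral over `ℤ_[p]`; such an `r` is already a unit, since the
integral closure of `ℤ_[p]` in `D` is local and its maximal ideal lies under `m`. -/
lemma PadicInt.isIntegral_of_zariskisMainProperty {D : Type*} [CommRing D] [IsDomain D]
    [Algebra ℤ_[p] D] [FaithfulSMul ℤ_[p] D] (m : Ideal D) [m.IsPrime] (hpm : (p : D) ∈ m)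
    (h : Algebra.ZariskisMainProperty ℤ_[p] m) : Algebra.IsIntegral ℤ_[p] D := by
  rw [Algebra.zariskisMainProperty_iff] at h
  obtain ⟨r, hrm, hr, H⟩ := h
  let A := integralClosure ℤ_[p] D
  have : IsLocalRing A := PadicInt.isLocalRing_of_isIntegral (p := p) A
  have hmax : (m.comap (algebraMap A D)).IsMaximal := by
    refine Ideal.isMaximal_of_isIntegral_of_isMaximal_comap (R := ℤ_[p]) _ ?_
    have hle : Ideal.span {(p : ℤ_[p])} ≤
        (m.comap (algebraMap A D)).comap (algebraMap ℤ_[p] A) := by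
      rw [Ideal.span_singleton_le_iff_mem, Ideal.mem_comap, Ideal.mem_comap,
        map_natCast, map_natCast]
      exact hpm
    have hpmax : (Ideal.span {(p : ℤ_[p])}).IsMaximal := by
      rw [← PadicInt.maximalIdeal_eq_span_p]; infer_instance
    exact hpmax.eq_of_le (Ideal.IsPrime.ne_top inferInstance) hle ▸ hpmax
  have hunit : IsUnit (⟨r, hr⟩ : A) := by
    by_contra hnu
    have : (⟨r, hr⟩ : A) ∈ m.comap (algebraMap A D) := by
      rw [IsLocalRing.eq_maximalIdeal hmax]
      exact hnu
    exact hrm this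
  refine ⟨fun x => ?_⟩
  obtain ⟨n, hn⟩ := H x
  obtain ⟨s, hs⟩ := hunit.exists_left_inv
  have hs' : (s : D) * r = 1 := congrArg Subtype.val hs
  have : x = (s : D) ^ n * (r ^ n * x) := by
    rw [← mul_assoc, ← mul_pow, hs', one_pow, one_mul]
  rw [this]
  exact (s.2.pow n).mul hn

end

/-! ### Integral points of domains of finite type over `ℤ_[p]` -/

section

variable {p : ℕ} [Fact p.Prime]

/-- The only nonzero prime ideal of `ℤ_[p]` is generated by `p`. -/
lemma PadicInt.faithfulSMul_of_ne_zero (D : Type*) [CommRing D] [IsDomain D]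
    [Algebra ℤ_[p] D] (hp : (p : D) ≠ 0) : FaithfulSMul ℤ_[p] D := by
  rw [faithfulSMul_iff_algebraMap_injective, RingHom.injective_iff_ker_eq_bot]
  by_contra hne
  have hmax : (RingHom.ker (algebraMap ℤ_[p] D)).IsMaximal :=
    Ring.DimensionLEOne.maximalOfPrime hne (RingHom.ker_isPrime _)
  have hmem : (p : ℤ_[p]) ∈ RingHom.ker (algebraMap ℤ_[p] D) := by
    rw [IsLocalRing.eq_maximalIdeal hmax, PadicInt.maximalIdeal_eq_span_p]
    exact Ideal.mem_span_singleton_self _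
  rw [RingHom.mem_ker, map_natCast] at hmem
  exact hp hmem

lemma PadicAlgCl.norm_p_lt_one : ‖(p : PadicAlgCl p)‖ < 1 := by
  rw [← map_natCast (algebraMap ℚ_[p] (PadicAlgCl p)), PadicAlgCl.norm_extends]
  exact Padic.norm_p_lt_one

lemma PadicAlgCl.exists_norm_pow_mul_le_one (T : Finset (PadicAlgCl p)) :
    ∃ n : ℕ, ∀ t ∈ T, ‖(p : PadicAlgCl p) ^ n * t‖ ≤ 1 := by
  have h : ∀ t ∈ T, ∀ᶠ n : ℕ in Filter.atTop, ‖(p : PadicAlgCl p) ^ n * t‖ ≤ 1 := by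
    intro t _
    have := (tendsto_pow_atTop_nhds_zero_of_norm_lt_one (norm_p_lt_one (p := p))).mul_const t
    rw [zero_mul] at this
    have := this.norm
    rw [norm_zero] at this
    exact (this.eventually_lt_const one_pos).mono fun _ => le_of_lt
  exact ((Filter.eventually_all_finset T).2 h).exists

/-- A domain `B` of finite type over `ℤ_[p]` with one point in the integers of `PadicAlgCl p` has
enough of them to detect any `g ≠ 0`, even compatibly with a given embedding of a subring `O` of
constants. -/
theorem PadicAlgCl.exists_integral_point (O B : Type*) [CommRing O] [IsDomain O] [CommRing B]
    [IsDomain B] [Algebra ℤ_[p] O] [Algebra.IsIntegral ℤ_[p] O] [Algebra O (PadicAlgCl p)]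
    [IsScalarTower ℤ_[p] O (PadicAlgCl p)] [FaithfulSMul O (PadicAlgCl p)]
    [Algebra ℤ_[p] B] [Algebra O B] [IsScalarTower ℤ_[p] O B] [Algebra.FiniteType ℤ_[p] B]
    (ev₀ : B →+* PadicAlgCl p) (hnorm : ∀ b, ‖ev₀ b‖ ≤ 1) {g : B} (hg : g ≠ 0) :
    ∃ θ : B →ₐ[O] PadicAlgCl p, θ g ≠ 0 ∧ ∀ b, ‖θ b‖ ≤ 1 := by
  have hpB : Ideal.span {(p : B)} ≠ ⊤ := by
    intro h
    obtain ⟨b, hb⟩ := Ideal.mem_span_singleton'.1 ((Ideal.eq_top_iff_one _).1 h)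
    have h3 := congrArg (fun b => ‖ev₀ b‖) hb
    simp only [map_mul, map_natCast, map_one, norm_mul, norm_one] at h3
    exact (mul_lt_one_of_nonneg_of_lt_one_right (hnorm b) (norm_nonneg _)
      PadicAlgCl.norm_p_lt_one).ne h3
  have hpB0 : (p : B) ≠ 0 := by
    intro h
    have := congrArg ev₀ h
    rw [map_natCast, map_zero] at this
    exact (Nat.cast_ne_zero.2 (Fact.out : p.Prime).ne_zero) this
  obtain ⟨m, hm, hpm⟩ := Ideal.exists_le_maximal _ hpB
  have hpm' : (p : B) ∈ m := hpm (Ideal.mem_span_singleton_self _)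
  obtain ⟨q, hqp, hgq, hqm, hZMP⟩ := exists_isPrime_zariskisMainProperty (R := ℤ_[p]) m (p : ℤ_[p])
    (by rw [← PadicInt.maximalIdeal_eq_span_p]; infer_instance) (by rwa [map_natCast])
    g (by rw [map_natCast]; exact mul_ne_zero hpB0 hg)
  rw [map_natCast] at hgq
  let D := B ⧸ q
  have hpD : (p : D) ≠ 0 := by
    intro h
    refine hgq (q.mul_mem_right _ ?_)
    rw [← Ideal.Quotient.eq_zero_iff_mem, map_natCast]; exact h
  have hfaith : FaithfulSMul ℤ_[p] D := PadicInt.faithfulSMul_of_ne_zero D hpD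
  have hmp : m.IsPrime := hm.isPrime
  have hmq : (m.map (Ideal.Quotient.mk q)).IsPrime :=
    Ideal.map_isPrime_of_surjective Ideal.Quotient.mk_surjective (by rwa [Ideal.mk_ker])
  have hDint : Algebra.IsIntegral ℤ_[p] D := by
    refine PadicInt.isIntegral_of_zariskisMainProperty (m.map (Ideal.Quotient.mk q)) ?_ hZMP
    rw [← map_natCast (Ideal.Quotient.mk q)]
    exact Ideal.mem_map_of_mem _ hpm'
  have hODfaith : FaithfulSMul O D := by
    rw [faithfulSMul_iff_algebraMap_injective]
    refine RingHom.injective_of_injective_comp_algebraMap (R := ℤ_[p]) _ ?_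
    rw [← IsScalarTower.algebraMap_eq]
    exact FaithfulSMul.algebraMap_injective _ _
  have hODint : Algebra.IsIntegral O D := Algebra.IsIntegral.tower_top ℤ_[p]
  have htf1 : Module.IsTorsionFree O (PadicAlgCl p) :=
    Module.isTorsionFree_iff_faithfulSMul.2 inferInstance
  have htf2 : Module.IsTorsionFree O D := Module.isTorsionFree_iff_faithfulSMul.2 hODfaith
  -- `D` is algebraic over `O`, so the embedding of `O` extends to `D`.
  let θ : D →ₐ[O] PadicAlgCl p := IsAlgClosed.lift
  have hθinj : Function.Injective θ := by
    refine RingHom.injective_of_injective_comp_algebraMap (R := O) θ.toRingHom ?_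
    have h : θ.toRingHom.comp (algebraMap O D) = algebraMap O (PadicAlgCl p) := θ.comp_algebraMap
    rw [h]
    exact FaithfulSMul.algebraMap_injective _ _
  refine ⟨θ.comp (Ideal.Quotient.mkₐ O q), fun h => ?_, fun b =>
    PadicAlgCl.norm_le_one_iff_isIntegral.2 ((Algebra.IsIntegral.isIntegral (R := ℤ_[p])
      (Ideal.Quotient.mkₐ O q b)).map (θ.restrictScalars ℤ_[p]))⟩
  have h3 : θ (Ideal.Quotient.mk q g) = 0 := h
  rw [← map_zero θ] at h3
  exact hgq (q.mul_mem_left _ (Ideal.Quotient.eq_zero_iff_mem.1 (hθinj h3)))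

end

section

variable {p : ℕ} [Fact p.Prime] {Γ : Type u} [CommGroup Γ]

/-- The evaluation of elements of the group algebra at a character. -/
noncomputable def evalChar {K : Type} [Field K] (ψ : Γ →* Kˣ) : MonoidAlgebra K Γ →ₐ[K] K :=
  MonoidAlgebra.lift K K Γ ((Units.coeHom K).comp ψ)

@[simp]
lemma evalChar_single {K : Type} [Field K] (ψ : Γ →* Kˣ) (γ : Γ) (c : K) :
    evalChar ψ (MonoidAlgebra.single γ c) = c * ψ γ := by
  simp [evalChar]

/-- If an irreducible closed subset of the character variety contains a character with values in the
integers, then the characters with values of norm `1` are Zariski dense in it. The subset is defined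
over a finitely generated ring `O` of integers of `PadicAlgCl p`, and the integral points of its
model over `O` are such characters because the elements of `Γ` are units. -/
theorem exists_unit_norm_char_notMem [Group.FG Γ] (P : Ideal (MonoidAlgebra (PadicAlgCl p) Γ))
    [P.IsPrime] (ψ₀ : Γ →* (PadicAlgCl p)ˣ) (hint : ∀ γ, ‖(ψ₀ γ : PadicAlgCl p)‖ ≤ 1)
    (hP : P ≤ (charPoint ψ₀).asIdeal) {g : MonoidAlgebra (PadicAlgCl p) Γ} (hg : g ∉ P) :
    ∃ ψ : Γ →* (PadicAlgCl p)ˣ, (∀ γ, ‖(ψ γ : PadicAlgCl p)‖ = 1) ∧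
      P ≤ (charPoint ψ).asIdeal ∧ g ∉ (charPoint ψ).asIdeal := by
  classical
  set K := PadicAlgCl p
  have hFG : Monoid.FG Γ := Group.fg_iff_monoid_fg.1 inferInstance
  have hnoeth : IsNoetherianRing (MonoidAlgebra K Γ) := Algebra.FiniteType.isNoetherianRing K _
  obtain ⟨s, hs⟩ := (isNoetherianRing_iff_ideal_fg _).1 hnoeth P
  let T : Finset K := (insert g s).biUnion fun h => h.coeff.support.image h.coeff
  obtain ⟨n, hn⟩ := PadicAlgCl.exists_norm_pow_mul_le_one T
  have hp0 : (p : K) ≠ 0 := by exact_mod_cast (Fact.out : p.Prime).ne_zero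
  -- `O` contains the coefficients of `p ^ n • g` and of the `p ^ n • h` for generators `h` of `P`.
  let O : Subalgebra ℤ_[p] K :=
    Algebra.adjoin ℤ_[p] ((T.image fun t => (p : K) ^ n * t : Finset K) : Set K)
  have hOft : Algebra.FiniteType ℤ_[p] O := (Subalgebra.fg_iff_finiteType O).1 ⟨_, rfl⟩
  have hOle : O ≤ integralClosure ℤ_[p] K := by
    refine Algebra.adjoin_le ?_
    intro x hx
    obtain ⟨t, ht, rfl⟩ := Finset.mem_image.1 hx
    exact PadicAlgCl.norm_le_one_iff_isIntegral.1 (hn t ht)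
  have hOint : Algebra.IsIntegral ℤ_[p] O :=
    ⟨fun x => (isIntegral_algHom_iff O.val Subtype.val_injective).1 (hOle x.2)⟩
  let j : MonoidAlgebra O Γ →+* MonoidAlgebra K Γ := MonoidAlgebra.mapRingHom Γ (algebraMap O K)
  have hj : ∀ h ∈ insert g s, ∃ h' : MonoidAlgebra O Γ, j h' = ((p : K) ^ n) • h := by
    intro h hh
    have : ((p : K) ^ n) • h ∈
        Set.range (MonoidAlgebra.map (M := Γ) (algebraMap O K : O →+ K)) := by
      rw [MonoidAlgebra.range_map]
      intro γ
      rw [MonoidAlgebra.coeff_smul, Finsupp.smul_apply, smul_eq_mul]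
      by_cases h0 : h.coeff γ = 0
      · exact ⟨0, by simp [h0]⟩
      · refine ⟨⟨_, Algebra.subset_adjoin (Finset.mem_coe.2 (Finset.mem_image_of_mem _
          (Finset.mem_biUnion.2 ⟨h, hh, Finset.mem_image_of_mem _
            (Finsupp.mem_support_iff.2 h0)⟩)))⟩, rfl⟩
    exact this
  have hnorm : ∀ b : MonoidAlgebra O Γ, ‖evalChar ψ₀ (j b)‖ ≤ 1 := by
    intro b
    induction b using MonoidAlgebra.induction_linear with
    | zero => simp
    | add a b ha hb =>
      rw [map_add, map_add]
      exact (IsUltrametricDist.norm_add_le_max _ _).trans (max_le ha hb)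
    | single γ c =>
      have : j (MonoidAlgebra.single γ c) = MonoidAlgebra.single γ (c : K) :=
        MonoidAlgebra.mapRingHom_single _ _ _
      rw [this, evalChar_single, norm_mul]
      exact mul_le_one₀ (PadicAlgCl.norm_le_one_iff_isIntegral.2 (hOle c.2)) (norm_nonneg _)
        (hint γ)
  let P' : Ideal (MonoidAlgebra O Γ) := P.comap j
  let B := MonoidAlgebra O Γ ⧸ P'
  have hft : Algebra.FiniteType ℤ_[p] (MonoidAlgebra O Γ) :=
    Algebra.FiniteType.trans hOft inferInstance
  have hftB : Algebra.FiniteType ℤ_[p] B := inferInstance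
  obtain ⟨g', hg'⟩ := hj g (Finset.mem_insert_self _ _)
  have hg'P : Ideal.Quotient.mk P' g' ≠ 0 := by
    rw [Ne, Ideal.Quotient.eq_zero_iff_mem]
    intro h
    have h : j g' ∈ P := h
    rw [hg'] at h
    have := P.smul_of_tower_mem ((p : K) ^ n)⁻¹ h
    rw [inv_smul_smul₀ (pow_ne_zero _ hp0)] at this
    exact hg this
  let ev₀ : B →+* K := Ideal.Quotient.lift P' ((evalChar ψ₀).toRingHom.comp j) fun a ha => hP ha
  obtain ⟨θ, hθg, hθnorm⟩ := PadicAlgCl.exists_integral_point O B ev₀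
    (fun b => by
      obtain ⟨b, rfl⟩ := Ideal.Quotient.mk_surjective b
      exact hnorm b) hg'P
  let Θ : MonoidAlgebra O Γ →+* K := θ.toRingHom.comp (Ideal.Quotient.mk P')
  let ψ : Γ →* Kˣ := ((Θ : MonoidAlgebra O Γ →* K).comp (MonoidAlgebra.of O Γ)).toHomUnits
  have hψ : ∀ γ, (ψ γ : K) = Θ (MonoidAlgebra.single γ 1) := fun γ => rfl
  have hcomp : ∀ b, evalChar ψ (j b) = Θ b := by
    have : (evalChar ψ).toRingHom.comp j = Θ := by
      refine MonoidAlgebra.ringHom_ext (fun c => ?_) (fun γ => ?_)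
      · have h1 : j (MonoidAlgebra.single 1 c) = MonoidAlgebra.single 1 (c : K) :=
          MonoidAlgebra.mapRingHom_single _ _ _
        have h2 : Θ (MonoidAlgebra.single 1 c) = c := θ.commutes c
        rw [h2]
        change evalChar ψ (j (MonoidAlgebra.single 1 c)) = _
        rw [h1, evalChar_single, map_one, Units.val_one, mul_one]
      · have h1 : j (MonoidAlgebra.single γ 1) = MonoidAlgebra.single γ (1 : K) := by
          simp [j]
        change evalChar ψ (j (MonoidAlgebra.single γ 1)) = _
        rw [h1, evalChar_single, one_mul, hψ]
    exact fun b => congrArg (fun f => f b) this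
  refine ⟨ψ, fun γ => ?_, ?_, ?_⟩
  · have h1 : ‖(ψ γ : K)‖ ≤ 1 := hθnorm _
    have h2 : ‖(ψ γ⁻¹ : K)‖ ≤ 1 := hθnorm _
    rw [map_inv, Units.val_inv_eq_inv_val, norm_inv] at h2
    have h3 : 0 < ‖(ψ γ : K)‖ := norm_pos_iff.2 (ψ γ).ne_zero
    exact le_antisymm h1 ((inv_le_one₀ h3).1 h2)
  · rw [← hs, Ideal.span_le]
    intro h hh
    obtain ⟨h', hh'⟩ := hj h (Finset.mem_insert_of_mem hh)
    have h1 : h' ∈ P' := by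
      change j h' ∈ P
      rw [hh']
      exact P.smul_of_tower_mem _ (hs ▸ Ideal.subset_span hh)
    have h2 : evalChar ψ (j h') = 0 := by
      rw [hcomp]
      change θ (Ideal.Quotient.mk P' h') = 0
      rw [Ideal.Quotient.eq_zero_iff_mem.2 h1, map_zero]
    rw [hh', map_smul, smul_eq_mul] at h2
    exact (mul_eq_zero.1 h2).resolve_left (pow_ne_zero _ hp0)
  · intro h
    have h : evalChar ψ g = 0 := h
    have h2 : evalChar ψ (j g') = 0 := by rw [hg', map_smul, h, smul_zero]
    rw [hcomp] at h2
    exact hθg h2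

end

/-! ### Continuous characters of the profinite completion -/

namespace ProfComp

variable (Γ : Type u) [CommGroup Γ]

instance : CompactSpace (ProfComp Γ) :=
  inferInstanceAs (CompactSpace (ProfiniteGrp.ProfiniteCompletion.completion (GrpCat.of Γ)))

lemma denseRange_eta : DenseRange (eta Γ) :=
  ProfiniteGrp.ProfiniteCompletion.denseRange (GrpCat.of Γ)

variable {Γ}

/-- The universal property of the profinite completion, for profinite groups in
the lowest universe. -/
lemma exists_continuous_extension (H : Type) [Group H] [TopologicalSpace H] [IsTopologicalGroup H]
    [CompactSpace H] [TotallyDisconnectedSpace H] (f : Γ →* H) :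
    ∃ F : ProfComp Γ →* H, Continuous F ∧ ∀ γ, F (eta Γ γ) = f γ := by
  have : TotallyDisconnectedSpace (ULift.{u} H) :=
    ⟨isTotallyDisconnected_of_image (f := ULift.down) continuous_uliftDown.continuousOn
      ULift.down_injective (isTotallyDisconnected_of_totallyDisconnectedSpace _)⟩
  let P : ProfiniteGrp.{u} := ProfiniteGrp.of (ULift.{u} H)
  let f' : Γ →* P := (MulEquiv.ulift.{0, u} (α := H)).symm.toMonoidHom.comp f
  let F := ProfiniteGrp.ProfiniteCompletion.lift (G := GrpCat.of Γ) (P := P) (GrpCat.ofHom f')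
  refine ⟨(MulEquiv.ulift.{0, u} (α := H)).toMonoidHom.comp F.hom.toMonoidHom,
    continuous_uliftDown.comp F.hom.continuous_toFun, fun γ => ?_⟩
  exact congrArg ULift.down (CategoryTheory.ConcreteCategory.congr_hom
    (ProfiniteGrp.ProfiniteCompletion.lift_eta (G := GrpCat.of Γ) (P := P) (GrpCat.ofHom f')) γ)

end ProfComp

section

variable {p : ℕ} [Fact p.Prime] {Γ : Type u} [CommGroup Γ]

/-- The norms of the values form a bounded subgroup of the positive reals. -/
lemma ContChar.norm_eq_one (χ : ContChar p Γ) (g : ProfComp Γ) :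
    ‖(χ.toHom g : PadicAlgCl p)‖ = 1 := by
  have hle : ∀ g, ‖(χ.toHom g : PadicAlgCl p)‖ ≤ 1 := by
    intro g
    by_contra hlt
    rw [not_le] at hlt
    have hc : Continuous fun g => ‖(χ.toHom g : PadicAlgCl p)‖ :=
      (Units.continuous_val.comp χ.continuous_toHom).norm
    obtain ⟨C, hC⟩ := (isCompact_range hc).bddAbove
    obtain ⟨n, hn⟩ := pow_unbounded_of_one_lt C hlt
    refine absurd (hC ⟨g ^ n, rfl⟩) (not_le.2 ?_)
    simpa using hn
  refine le_antisymm (hle g) ?_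
  have h2 := hle g⁻¹
  rw [map_inv, Units.val_inv_eq_inv_val, norm_inv] at h2
  exact (inv_le_one₀ (norm_pos_iff.2 (χ.toHom g).ne_zero)).1 h2

lemma PadicAlgCl.isCompact_units_of_norm_eq_one (E : IntermediateField ℚ_[p] (PadicAlgCl p))
    [FiniteDimensional ℚ_[p] E] :
    IsCompact {u : (PadicAlgCl p)ˣ | ‖(u : PadicAlgCl p)‖ = 1 ∧ (u : PadicAlgCl p) ∈ E} := by
  have : ProperSpace E := FiniteDimensional.proper ℚ_[p] E
  have hne : ∀ x : Metric.sphere (0 : E) 1, ((x : E) : PadicAlgCl p) ≠ 0 := by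
    rintro ⟨x, hx⟩ h
    have h : x = 0 := Subtype.ext h
    simp [h] at hx
  have hc : Continuous fun x : Metric.sphere (0 : E) 1 => Units.mk0 _ (hne x) := by
    rw [Units.continuous_iff]
    have h1 : Continuous fun x : Metric.sphere (0 : E) 1 => ((x : E) : PadicAlgCl p) :=
      continuous_subtype_val.comp continuous_subtype_val
    exact ⟨h1, h1.inv₀ hne⟩
  convert isCompact_range hc using 1
  ext u
  constructor
  · rintro ⟨h1, h2⟩
    exact ⟨⟨⟨u, h2⟩, by simpa using h1⟩, Units.ext rfl⟩
  · rintro ⟨⟨x, hx⟩, rfl⟩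
    exact ⟨by simpa using hx, x.2⟩

/-- The characters of `Γ` that extend to continuous characters of its profinite completion are
those with values of norm `1`. -/
theorem exists_contChar [Group.FG Γ] (ψ : Γ →* (PadicAlgCl p)ˣ)
    (hψ : ∀ γ, ‖(ψ γ : PadicAlgCl p)‖ = 1) :
    ∃ χ : ContChar p Γ, χ.toHom.comp (ProfComp.eta Γ) = ψ := by
  obtain ⟨S, hS⟩ := (Group.fg_def.1 (inferInstance : Group.FG Γ))
  let T : Set (PadicAlgCl p) := (fun γ => (ψ γ : PadicAlgCl p)) '' (S : Set Γ)
  let E := IntermediateField.adjoin ℚ_[p] T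
  have hTfin : T.Finite := S.finite_toSet.image _
  have : Finite T := hTfin
  have hE : FiniteDimensional ℚ_[p] E :=
    IntermediateField.finiteDimensional_adjoin fun x _ => Algebra.IsIntegral.isIntegral x
  let H : Subgroup (PadicAlgCl p)ˣ :=
    { carrier := {u | ‖(u : PadicAlgCl p)‖ = 1 ∧ (u : PadicAlgCl p) ∈ E}
      mul_mem' := fun {a b} ha hb => ⟨by
        rw [Units.val_mul, norm_mul, ha.1, hb.1, one_mul], E.mul_mem ha.2 hb.2⟩
      one_mem' := ⟨by simp, E.one_mem⟩
      inv_mem' := fun {a} ha => ⟨by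
        rw [Units.val_inv_eq_inv_val, norm_inv, ha.1, inv_one], by
        rw [Units.val_inv_eq_inv_val]; exact E.inv_mem ha.2⟩ }
  have hψH : ∀ γ, ψ γ ∈ H := by
    have hle : Subgroup.closure (S : Set Γ) ≤ H.comap ψ := by
      rw [Subgroup.closure_le]
      exact fun γ hγ => ⟨hψ γ, IntermediateField.subset_adjoin _ _ ⟨γ, hγ, rfl⟩⟩
    rw [hS] at hle
    exact fun γ => hle (Subgroup.mem_top γ)
  have hHc : CompactSpace H :=
    isCompact_iff_compactSpace.1 (PadicAlgCl.isCompact_units_of_norm_eq_one E)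
  have hHt : TotallyDisconnectedSpace H :=
    ⟨isTotallyDisconnected_of_image
      (f := fun u : H => ((u : (PadicAlgCl p)ˣ) : PadicAlgCl p))
      (Units.continuous_val.comp continuous_subtype_val).continuousOn
      (Units.val_injective.comp Subtype.val_injective)
      (isTotallyDisconnected_of_totallyDisconnectedSpace _)⟩
  obtain ⟨F, hF, hFψ⟩ := ProfComp.exists_continuous_extension H (ψ.codRestrict H hψH)
  refine ⟨⟨H.subtype.comp F, continuous_subtype_val.comp hF, E, hE, fun g => (F g).2.2⟩, ?_⟩
  ext γ
  have := congrArg (fun u : H => ((u : (PadicAlgCl p)ˣ) : PadicAlgCl p)) (hFψ γ)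
  simpa using this

/-- On an irreducible closed subset of the character variety containing one continuous character,
the continuous characters are Zariski dense. -/
theorem exists_contChar_notMem [Group.FG Γ] (P : Ideal (MonoidAlgebra (PadicAlgCl p) Γ))
    [P.IsPrime] (χ₀ : ContChar p Γ) (hP : P ≤ (phi χ₀).asIdeal)
    {g : MonoidAlgebra (PadicAlgCl p) Γ} (hg : g ∉ P) :
    ∃ χ : ContChar p Γ, P ≤ (phi χ).asIdeal ∧ g ∉ (phi χ).asIdeal := by
  obtain ⟨ψ, hψ, hPψ, hgψ⟩ := exists_unit_norm_char_notMem P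
    (χ₀.toHom.comp (ProfComp.eta Γ)) (fun γ => (χ₀.norm_eq_one (ProfComp.eta Γ γ)).le) hP hg
  obtain ⟨χ, rfl⟩ := exists_contChar ψ hψ
  exact ⟨χ, hPψ, hgψ⟩

end

/-! ### Homomorphisms to ultrametric vector spaces and the weights of `σ` -/

section

variable {p : ℕ} [Fact p.Prime] {G : Type u} [CommGroup G] [TopologicalSpace G]

/-- The canonical map from a topological abelian group to its pro-`p` completion. -/
def ProPCompletion.of (g : G) : ProPCompletion p G :=
  ⟨fun _ => Additive.ofMul (QuotientGroup.mk g), fun _ _ _ => rfl⟩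

/-- The canonical map from a topological abelian group to its rationalized pro-`p` completion. -/
noncomputable def RatProP.of (g : G) : RatProP p G := (1 : ℚ_[p]) ⊗ₜ ProPCompletion.of g

lemma RatProP.map_of {H : Type u} [CommGroup H] [TopologicalSpace H] (f : G →ₜ* H) (g : G) :
    RatProP.map p f (RatProP.of g) = RatProP.of (f g) := rfl

/-- A relation in the rationalization holds before rationalizing after multiplication by some
`r ≠ 0`. -/
lemma RatProP.exists_smul_eq_of_eq_smul {g h : G} {z : ℤ_[p]}
    (hgh : (RatProP.of g : RatProP p G) = (z : ℚ_[p]) • RatProP.of h) :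
    ∃ r : ℤ_[p], r ≠ 0 ∧ r • (ProPCompletion.of g : ProPCompletion p G) =
      (r * z) • ProPCompletion.of h := by
  have h1 : TensorProduct.mk ℤ_[p] ℚ_[p] (ProPCompletion p G) 1
      (ProPCompletion.of g - z • ProPCompletion.of h) = 0 := by
    rw [map_sub, map_smul, sub_eq_zero]
    exact hgh
  rw [IsLocalizedModule.eq_zero_iff (nonZeroDivisors ℤ_[p])] at h1
  obtain ⟨⟨r, hr⟩, h2⟩ := h1
  refine ⟨r, nonZeroDivisors.ne_zero hr, ?_⟩
  have h3 := (smul_sub r (ProPCompletion.of g) (z • ProPCompletion.of h)).symm.trans h2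
  rw [mul_smul]
  exact sub_eq_zero.1 h3

variable [IsTopologicalGroup G] [CompactSpace G]
variable {V : Type*} [NormedAddCommGroup V] [NormedSpace ℚ_[p] V] [IsUltrametricDist V]

/-- The preimage of a small ball is a subgroup, as the norm is ultrametric, and the quotient by it
is a `p`-group, as `p ^ k • v` tends to `0` for every vector `v`. -/
lemma exists_openPSubgroup_norm_le (ℓ : G →* Multiplicative V) (hℓ : Continuous ℓ) {ε : ℝ}
    (hε : 0 < ε) : ∃ U : OpenPSubgroup p G, ∀ g ∈ U.1, ‖(ℓ g).toAdd‖ ≤ ε := by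
  have hc : Continuous fun g => (ℓ g).toAdd := hℓ
  let U : Subgroup G :=
    { carrier := {g | ‖(ℓ g).toAdd‖ ≤ ε}
      mul_mem' := fun {a b} ha hb => by
        change ‖(ℓ (a * b)).toAdd‖ ≤ ε
        rw [map_mul, toAdd_mul]
        exact (IsUltrametricDist.norm_add_le_max _ _).trans (max_le ha hb)
      one_mem' := by
        change ‖(ℓ 1).toAdd‖ ≤ ε
        rw [map_one, toAdd_one, norm_zero]; exact hε.le
      inv_mem' := fun {a} ha => by
        change ‖(ℓ a⁻¹).toAdd‖ ≤ ε
        rw [map_inv, toAdd_inv, norm_neg]; exact ha }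
  have hUopen : IsOpen (U : Set G) := by
    have : (U : Set G) = (fun g => (ℓ g).toAdd) ⁻¹' Metric.closedBall 0 ε := by
      ext g; simp [U]
    rw [this]
    exact (IsUltrametricDist.isOpen_closedBall _ hε.ne').preimage hc
  have hfin : Finite (G ⧸ U) := Subgroup.quotient_finite_of_isOpen U hUopen
  have hpg : IsPGroup p (G ⧸ U) := by
    intro x
    obtain ⟨g, rfl⟩ := QuotientGroup.mk_surjective x
    have h1 : Filter.Tendsto (fun k : ℕ => ‖((p : ℚ_[p]) ^ k) • (ℓ g).toAdd‖) Filter.atTop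
        (nhds 0) := by
      have := ((tendsto_pow_atTop_nhds_zero_of_norm_lt_one
        (Padic.norm_p_lt_one (p := p))).smul_const (ℓ g).toAdd).norm
      simpa using this
    obtain ⟨k, hk⟩ := (h1.eventually_lt_const hε).exists
    refine ⟨k, ?_⟩
    rw [← QuotientGroup.mk_pow, QuotientGroup.eq_one_iff]
    change ‖(ℓ (g ^ p ^ k)).toAdd‖ ≤ ε
    rw [map_pow, toAdd_pow, ← Nat.cast_smul_eq_nsmul ℚ_[p], Nat.cast_pow]
    exact hk.le
  exact ⟨⟨U, hUopen, (IsPGroup.iff_card.1 hpg)⟩, fun g hg => hg⟩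

/-- A `ℤ_[p]`-proportionality between the images of two elements in the rationalized pro-`p`
completion is respected by every continuous homomorphism to an ultrametric vector space: such a
homomorphism is seen by the quotients of `p`-power order up to arbitrarily small error. -/
theorem RatProP.map_eq_smul_of_eq_smul (ℓ : G →* Multiplicative V) (hℓ : Continuous ℓ) {g h : G}
    {z : ℤ_[p]} (hgh : (RatProP.of g : RatProP p G) = (z : ℚ_[p]) • RatProP.of h) :
    (ℓ g).toAdd = (z : ℚ_[p]) • (ℓ h).toAdd := by
  obtain ⟨r, hr0, hr⟩ := RatProP.exists_smul_eq_of_eq_smul hgh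
  have hr0' : (r : ℚ_[p]) ≠ 0 := by simpa using hr0
  suffices H : ∀ ε : ℝ, 0 < ε →
      ‖(r : ℚ_[p]) • (ℓ g).toAdd - ((r * z : ℤ_[p]) : ℚ_[p]) • (ℓ h).toAdd‖ ≤ ε by
    have h0 : (r : ℚ_[p]) • (ℓ g).toAdd - ((r * z : ℤ_[p]) : ℚ_[p]) • (ℓ h).toAdd = 0 := by
      rw [← norm_le_zero_iff]
      exact le_of_forall_pos_le_add fun ε hε => by simpa using H ε hε
    rw [PadicInt.coe_mul, mul_smul, ← smul_sub, smul_eq_zero, or_iff_right hr0', sub_eq_zero] at h0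
    exact h0
  intro ε hε
  obtain ⟨U, hU⟩ := exists_openPSubgroup_norm_le (p := p) ℓ hℓ hε
  have htend : ∀ v : V, Filter.Tendsto (fun n : ℕ => (p : ℝ) ^ (-n : ℤ) * ‖v‖) Filter.atTop
      (nhds 0) := by
    intro v
    have := ((tendsto_pow_atTop_nhds_zero_of_norm_lt_one
        (Padic.norm_p_lt_one (p := p))).smul_const v).norm
    simpa [norm_smul] using this
  obtain ⟨n, hnU, hn1, hn2⟩ := ((Filter.eventually_ge_atTop U.exponent).and
    (((htend (ℓ g).toAdd).eventually_lt_const hε).and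
      ((htend (ℓ h).toAdd).eventually_lt_const hε))).exists
  -- `ℤ_[p]` acts on the quotient by `U` through integer approximations, whose error is at most `ε`.
  have happr : ∀ (x : ℤ_[p]) (v : V), (p : ℝ) ^ (-n : ℤ) * ‖v‖ < ε →
      ‖(x : ℚ_[p]) • v - (x.appr n) • v‖ ≤ ε := by
    intro x v hv
    have h1 : ‖x - (x.appr n : ℤ_[p])‖ ≤ (p : ℝ) ^ (-n : ℤ) :=
      (PadicInt.norm_le_pow_iff_mem_span_pow _ _).2 (PadicInt.appr_spec n x)
    rw [← Nat.cast_smul_eq_nsmul ℚ_[p], ← sub_smul, norm_smul]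
    refine le_trans (mul_le_mul_of_nonneg_right ?_ (norm_nonneg v)) hv.le
    simpa [PadicInt.norm_def] using h1
  have hmid : ‖(r.appr n) • (ℓ g).toAdd - ((r * z).appr n) • (ℓ h).toAdd‖ ≤ ε := by
    have h1 : r • (Additive.ofMul (QuotientGroup.mk g) : U.Quot) =
        (r * z) • Additive.ofMul (QuotientGroup.mk h) :=
      congrFun (congrArg Subtype.val hr) U
    rw [U.smul_eq_appr_nsmul _ _ hnU, U.smul_eq_appr_nsmul _ _ hnU, ← ofMul_pow, ← ofMul_pow,
      ← QuotientGroup.mk_pow, ← QuotientGroup.mk_pow] at h1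
    have h2 := QuotientGroup.eq.1 (Additive.ofMul.injective h1)
    have h3 := hU _ h2
    rw [map_mul, map_inv, map_pow, map_pow, toAdd_mul, toAdd_inv, toAdd_pow, toAdd_pow,
      ← norm_neg, neg_add_rev, neg_neg] at h3
    rwa [sub_eq_add_neg, add_comm]
  have hsplit : (r : ℚ_[p]) • (ℓ g).toAdd - ((r * z : ℤ_[p]) : ℚ_[p]) • (ℓ h).toAdd =
      ((r : ℚ_[p]) • (ℓ g).toAdd - (r.appr n) • (ℓ g).toAdd) +
      (((r.appr n) • (ℓ g).toAdd - ((r * z).appr n) • (ℓ h).toAdd) -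
      (((r * z : ℤ_[p]) : ℚ_[p]) • (ℓ h).toAdd - ((r * z).appr n) • (ℓ h).toAdd)) := by abel
  rw [hsplit]
  refine (IsUltrametricDist.norm_add_le_max _ _).trans (max_le (happr _ _ hn1) ?_)
  rw [sub_eq_add_neg]
  refine (IsUltrametricDist.norm_add_le_max _ _).trans (max_le hmid ?_)
  rw [norm_neg]
  exact happr _ _ hn2

end

section

variable {p : ℕ} [Fact p.Prime] {Γ : Type u} [CommGroup Γ]
variable {V : Type*} [NormedAddCommGroup V] [NormedSpace ℚ_[p] V] [IsUltrametricDist V]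

/-- The weights of `σ` on the rationalized pro-`p` completion give the quadratic relation
`(σ - α⁻¹) (σ - α⁻²) = 0` on every continuous homomorphism to an ultrametric vector space. -/
theorem ActsWithWeights.quadratic_relation {N : Subgroup Γ} {σ : ProfComp Γ ≃ₜ* ProfComp Γ}
    {α : ℤ_[p]ˣ} (hσ : ActsWithWeights p N σ α) (ℓ : ProfComp Γ →* Multiplicative V)
    (hℓ : Continuous ℓ) {a : ℚ_[p]} (ha : a = ((α⁻¹ : ℤ_[p]ˣ) : ℤ_[p])) (g : ProfComp Γ) :
    (ℓ (σ (σ g))).toAdd - a ^ 2 • (ℓ (σ g)).toAdd =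
      a • ((ℓ (σ g)).toAdd - a ^ 2 • (ℓ g).toAdd) := by
  have ha1 : (((α ^ (-1 : ℤ) : ℤ_[p]ˣ) : ℤ_[p]) : ℚ_[p]) = a := by rw [ha, zpow_neg_one]
  have ha2 : (((α ^ (-2 : ℤ) : ℤ_[p]ˣ) : ℤ_[p]) : ℚ_[p]) = a ^ 2 := by
    rw [ha, show (-2 : ℤ) = (-1) * (2 : ℕ) by norm_num, zpow_mul, zpow_neg_one, zpow_natCast,
      Units.val_pow_eq_pow_val, PadicInt.coe_pow]
  -- `ℓ'` is `ℓ ∘ (σ - α⁻²)`: it vanishes on `naturalSubgroup N` by the weight there, and its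
  -- descent to the quotient has weight `α⁻¹`.
  let ℓ' : ProfComp Γ →* Multiplicative V := MonoidHom.mk'
    (fun g => Multiplicative.ofAdd ((ℓ (σ g)).toAdd - a ^ 2 • (ℓ g).toAdd)) (by
      intro x y
      have h1 : ℓ (σ (x * y)) = ℓ (σ x) * ℓ (σ y) := by rw [map_mul σ, map_mul ℓ]
      rw [← ofAdd_add, h1, map_mul ℓ, toAdd_mul, toAdd_mul, smul_add]
      congr 1
      abel)
  have hℓ' : Continuous ℓ' := by
    have h1 : Continuous fun g => (ℓ g).toAdd := hℓ
    have h2 : Continuous fun g => (ℓ (σ g)).toAdd := h1.comp σ.continuous_toFun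
    exact h2.sub (h1.const_smul _)
  have hker : ∀ x ∈ naturalSubgroup N, ℓ' x = 1 := by
    rintro _ ⟨n, rfl⟩
    have h1 := hσ.weight_two (RatProP.of n)
    rw [RatProP.map_of, RatProP.map_of] at h1
    have h2 := RatProP.map_eq_smul_of_eq_smul ℓ hℓ h1
    rw [ha2] at h2
    exact congrArg Multiplicative.ofAdd (sub_eq_zero.2 h2)
  let ℓ'' : (ProfComp Γ ⧸ naturalSubgroup N) →* Multiplicative V :=
    QuotientGroup.lift (naturalSubgroup N) ℓ' hker
  have hℓ'' : Continuous ℓ'' := by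
    refine (QuotientGroup.isQuotientMap_mk (N := naturalSubgroup N)).continuous_iff.2 ?_
    exact hℓ'
  have h1 := hσ.weight_one (RatProP.of g)
  rw [RatProP.map_of, RatProP.map_of, RatProP.map_of] at h1
  have h2 := RatProP.map_eq_smul_of_eq_smul ℓ'' hℓ'' h1
  rw [ha1] at h2
  exact h2

end

/-! ### Exponential and logarithm over `ℂ_[p]` -/

section Exp

variable (p : ℕ) [Fact p.Prime]

open NormedSpace in
/-- The radius is at least `1 / p`, since `n!` has `p`-adic valuation at most `n`. -/
lemma PadicComplex.expSeries_radius_pos : 0 < (expSeries ℂ_[p] ℂ_[p]).radius := by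
  have hp0 : (0 : ℝ) < p := by exact_mod_cast (Fact.out : p.Prime).pos
  have hp1 : (1 : ℝ) ≤ p := by exact_mod_cast (Fact.out : p.Prime).one_lt.le
  have hbound : ∀ n : ℕ, ‖((n.factorial : ℂ_[p]))⁻¹‖ ≤ (p : ℝ) ^ n := by
    intro n
    have h0 : (n.factorial : ℚ_[p]) ≠ 0 := Nat.cast_ne_zero.2 n.factorial_ne_zero
    have h1 : ‖(n.factorial : ℂ_[p])‖ = ‖(n.factorial : ℚ_[p])‖ := by
      rw [← map_natCast (algebraMap ℚ_[p] ℂ_[p]), norm_algebraMap']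
    rw [norm_inv, h1, Padic.norm_eq_zpow_neg_valuation h0, Padic.valuation_natCast, zpow_neg,
      inv_inv, zpow_natCast]
    refine pow_le_pow_right₀ hp1 ?_
    have h2 := sub_one_mul_padicValNat_factorial (p := p) n
    have h3 : 1 ≤ p - 1 := Nat.le_sub_one_of_lt (Fact.out : p.Prime).one_lt
    nlinarith [Nat.sub_le n (p.digits n).sum]
  let r : NNReal := (p : NNReal)⁻¹
  have hr : (r : ENNReal) ≤ (expSeries ℂ_[p] ℂ_[p]).radius := by
    refine FormalMultilinearSeries.le_radius_of_bound _ 1 fun n => ?_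
    rw [expSeries_eq_ofScalars, FormalMultilinearSeries.ofScalars_norm]
    rw [show (r : ℝ) = (p : ℝ)⁻¹ by simp [r], inv_pow, ← div_eq_mul_inv, div_le_one (by positivity)]
    exact hbound n
  refine lt_of_lt_of_le ?_ hr
  rw [ENNReal.coe_pos, ← NNReal.coe_pos]
  rw [show (r : ℝ) = (p : ℝ)⁻¹ by simp [r]]
  positivity

/-- The `p`-adic exponential maps a small ball isomorphically onto an open subgroup of the
multiplicative group; `log` is its inverse there. -/
lemma PadicComplex.exists_log : ∃ (r : ℝ) (log : ℂ_[p] → ℂ_[p]), 0 < r ∧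
    Metric.ball (0 : ℂ_[p]) r ⊆ Metric.eball 0 (NormedSpace.expSeries ℂ_[p] ℂ_[p]).radius ∧
    IsOpen (NormedSpace.exp '' Metric.ball (0 : ℂ_[p]) r) ∧
    (∀ x ∈ Metric.ball (0 : ℂ_[p]) r, log (NormedSpace.exp x) = x) ∧
    ContinuousOn log (NormedSpace.exp '' Metric.ball (0 : ℂ_[p]) r) := by
  have hpos := PadicComplex.expSeries_radius_pos p
  have h0 : HasStrictDerivAt (NormedSpace.exp : ℂ_[p] → ℂ_[p]) 1 0 := by
    have := hasStrictDerivAt_exp_of_mem_ball (𝕂 := ℂ_[p]) (x := 0) (by simpa using hpos)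
    rwa [NormedSpace.exp_zero] at this
  have h1 := h0.hasStrictFDerivAt_equiv one_ne_zero
  let e := h1.toOpenPartialHomeomorph
  have he : (e : ℂ_[p] → ℂ_[p]) = NormedSpace.exp := h1.toOpenPartialHomeomorph_coe
  have hsrc : e.source ∈ nhds (0 : ℂ_[p]) :=
    e.open_source.mem_nhds h1.mem_toOpenPartialHomeomorph_source
  obtain ⟨r, hr, hrsub⟩ := Metric.mem_nhds_iff.1 (Filter.inter_mem hsrc
    (Metric.eball_mem_nhds (0 : ℂ_[p]) hpos))
  have hsub : Metric.ball (0 : ℂ_[p]) r ⊆ e.source := fun x hx => (hrsub hx).1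
  refine ⟨r, e.symm, hr, fun x hx => (hrsub hx).2, ?_, fun x hx => ?_, ?_⟩
  · rw [← he]
    exact e.isOpen_image_of_subset_source Metric.isOpen_ball hsub
  · rw [← he]
    exact e.left_inv (hsub hx)
  · refine e.continuousOn_symm.mono ?_
    rw [← he]
    rintro _ ⟨x, hx, rfl⟩
    exact e.map_source (hsub hx)

variable {p}

/-- Every continuous character of a compact abelian group with values in `ℂ_[p]` has a logarithm:
a homomorphism `ℓ` to the additive group whose exponential is the character near the identity,
and which vanishes only where the character takes roots of unity as values. -/
theorem exists_log_char {G : Type*} [CommGroup G] [TopologicalSpace G] [IsTopologicalGroup G]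
    [CompactSpace G] (X : G →* ℂ_[p]) (hX : Continuous X) :
    ∃ (ℓ : G →* Multiplicative ℂ_[p]) (U : Subgroup G), Continuous ℓ ∧ IsOpen (U : Set G) ∧
      (∀ g, ℓ g = 1 → ∃ m : ℕ, 0 < m ∧ X g ^ m = 1) ∧
      ∀ g ∈ U, X g = NormedSpace.exp (ℓ g).toAdd := by
  obtain ⟨r, log, hr, hball, hopen, hlog, hcont⟩ := PadicComplex.exists_log p
  have hadd : ∀ x ∈ Metric.ball (0 : ℂ_[p]) r, ∀ y ∈ Metric.ball (0 : ℂ_[p]) r,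
      x + y ∈ Metric.ball (0 : ℂ_[p]) r := by
    intro x hx y hy
    rw [mem_ball_zero_iff] at *
    exact (IsUltrametricDist.norm_add_le_max _ _).trans_lt (max_lt hx hy)
  have hexp : ∀ x ∈ Metric.ball (0 : ℂ_[p]) r, ∀ y ∈ Metric.ball (0 : ℂ_[p]) r,
      NormedSpace.exp (x + y) = NormedSpace.exp x * NormedSpace.exp y :=
    fun x hx y hy => NormedSpace.exp_add_of_mem_ball (𝕂 := ℂ_[p]) (hball hx) (hball hy)
  have h0 : (0 : ℂ_[p]) ∈ Metric.ball (0 : ℂ_[p]) r := Metric.mem_ball_self hr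
  have hXinv : ∀ g, X g⁻¹ * X g = 1 := fun g => by rw [← map_mul, inv_mul_cancel, map_one]
  let U : Subgroup G :=
    { carrier := {g | X g ∈ NormedSpace.exp '' Metric.ball (0 : ℂ_[p]) r}
      mul_mem' := by
        rintro a b ⟨x, hx, hxa⟩ ⟨y, hy, hyb⟩
        exact ⟨x + y, hadd x hx y hy, by rw [hexp x hx y hy, hxa, hyb, map_mul]⟩
      one_mem' := ⟨0, h0, by rw [NormedSpace.exp_zero, map_one]⟩
      inv_mem' := by
        rintro a ⟨x, hx, hxa⟩
        have hx' : -x ∈ Metric.ball (0 : ℂ_[p]) r := by simpa using hx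
        refine ⟨-x, hx', ?_⟩
        have h1 := hexp (-x) hx' x hx
        rw [neg_add_cancel, NormedSpace.exp_zero, hxa] at h1
        have hne : X a ≠ 0 := right_ne_zero_of_mul_eq_one (hXinv a)
        exact mul_right_cancel₀ hne (h1.symm.trans (hXinv a).symm) }
  have hUopen : IsOpen (U : Set G) := hopen.preimage hX
  have hUfin : Finite (G ⧸ U) := Subgroup.quotient_finite_of_isOpen U hUopen
  have hidx : U.index ≠ 0 := Subgroup.index_ne_zero_of_finite
  set m := U.index
  have hpow : ∀ g, g ^ m ∈ U := fun g => U.pow_index_mem g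
  have hmC : (m : ℂ_[p]) ≠ 0 := Nat.cast_ne_zero.2 hidx
  have hlogmul : ∀ a ∈ U, ∀ b ∈ U, log (X (a * b)) = log (X a) + log (X b) := by
    rintro a ⟨x, hx, hxa⟩ b ⟨y, hy, hyb⟩
    rw [map_mul, ← hxa, ← hyb, ← hexp x hx y hy, hlog x hx, hlog y hy, hlog _ (hadd x hx y hy)]
  -- `X (g ^ m)` is in the domain of `log` for all `g`, as `m` is the index of `U`.
  let ℓ : G →* Multiplicative ℂ_[p] := MonoidHom.mk'
    (fun g => Multiplicative.ofAdd ((m : ℂ_[p])⁻¹ * log (X (g ^ m)))) (fun a b => by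
      rw [mul_pow, hlogmul _ (hpow a) _ (hpow b), mul_add, ofAdd_add])
  have hℓ : Continuous ℓ := by
    have h1 : Continuous fun g => log (X (g ^ m)) :=
      hcont.comp_continuous (hX.comp (continuous_pow m)) hpow
    exact h1.const_mul _
  refine ⟨ℓ, U, hℓ, hUopen, fun g hg => ⟨m, Nat.pos_of_ne_zero hidx, ?_⟩, ?_⟩
  · obtain ⟨x, hx, hxg⟩ := hpow g
    have h1 : (m : ℂ_[p])⁻¹ * log (X (g ^ m)) = 0 := hg
    rw [← hxg, hlog x hx] at h1
    have hx0 : x = 0 := (mul_eq_zero.1 h1).resolve_left (inv_ne_zero hmC)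
    rw [← map_pow, ← hxg, hx0, NormedSpace.exp_zero]
  · rintro g ⟨x, hx, hxg⟩
    have hn : ∀ n : ℕ, n • x ∈ Metric.ball (0 : ℂ_[p]) r ∧
        NormedSpace.exp (n • x) = X g ^ n := by
      intro n
      induction n with
      | zero => exact ⟨by simpa using hr, by rw [zero_smul, NormedSpace.exp_zero, pow_zero]⟩
      | succ n ih =>
        rw [succ_nsmul]
        exact ⟨hadd _ ih.1 _ hx, by rw [hexp _ ih.1 _ hx, ih.2, hxg, pow_succ]⟩
    have h1 : (ℓ g).toAdd = x := by
      change (m : ℂ_[p])⁻¹ * log (X (g ^ m)) = x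
      rw [map_pow, ← (hn m).2, hlog _ (hn m).1, nsmul_eq_mul, inv_mul_cancel_left₀ hmC]
    rw [h1, hxg]

end Exp

/-! ### Linear independence of exponentials -/

section Independence

open Polynomial

variable {p : ℕ} [Fact p.Prime]

/-- The polynomial `u x + (u² + 2 u) y`; for `u = t - 1` it is `(t - 1) x + (t² - 1) y`. -/
noncomputable def weightPoly (q : ℂ_[p] × ℂ_[p]) : ℂ_[p][X] := C q.1 * X + C q.2 * (X ^ 2 + 2 * X)

lemma eval_weightPoly (q : ℂ_[p] × ℂ_[p]) (u : ℂ_[p]) :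
    (weightPoly q).eval u = u * q.1 + (u ^ 2 + 2 * u) * q.2 := by
  simp [weightPoly]; ring

lemma derivative_weightPoly_ne {q q' : ℂ_[p] × ℂ_[p]} (h : q ≠ q') :
    derivative (weightPoly q) ≠ derivative (weightPoly q') := by
  intro heq
  have hd : ∀ q : ℂ_[p] × ℂ_[p],
      derivative (weightPoly q) = C (q.1 + 2 * q.2) + C (2 * q.2) * X := by
    intro q
    have h2 : (C 2 : ℂ_[p][X]) = 2 := map_ofNat C 2
    simp only [weightPoly, derivative_mul, derivative_C, derivative_X, derivative_X_pow, map_add,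
      map_mul]
    simp [h2]
    ring
  rw [hd, hd] at heq
  have h1 := congrArg (fun f => f.coeff 1) heq
  have h0 := congrArg (fun f => f.coeff 0) heq
  simp at h0 h1
  refine h (Prod.ext ?_ h1)
  rw [h1] at h0
  simpa using h0

/-- For `R ≠ 0` the degree of `R'` is less than that of `s R`. -/
lemma Polynomial.eq_zero_of_derivative_add_mul_eq_zero {K : Type*} [Field K] {s R : K[X]}
    (hs : s ≠ 0) (h : derivative R + s * R = 0) : R = 0 := by
  by_contra hR
  have h1 : (derivative R).degree < R.degree := degree_derivative_lt hR
  have h2 : R.degree ≤ (s * R).degree := by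
    rw [mul_comm]
    exact degree_le_mul_left R hs
  have h3 : derivative R = -(s * R) := eq_neg_of_add_eq_zero_left h
  rw [h3, degree_neg] at h1
  exact absurd h1 (not_lt.2 h2)

lemma eventually_hasDerivAt_exp_weightPoly (q : ℂ_[p] × ℂ_[p]) :
    ∀ᶠ u in nhds (0 : ℂ_[p]), HasDerivAt (fun u => NormedSpace.exp ((weightPoly q).eval u))
      (NormedSpace.exp ((weightPoly q).eval u) * (derivative (weightPoly q)).eval u) u := by
  have hc : Filter.Tendsto (fun u => (weightPoly q).eval u) (nhds 0) (nhds 0) := by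
    have := (weightPoly q).continuous.tendsto 0
    rwa [eval_weightPoly, show (0 : ℂ_[p]) * q.1 + (0 ^ 2 + 2 * 0) * q.2 = 0 by ring] at this
  filter_upwards [hc (Metric.eball_mem_nhds (0 : ℂ_[p]) (PadicComplex.expSeries_radius_pos p))]
    with u hu
  exact (hasDerivAt_exp_of_mem_ball hu).comp u ((weightPoly q).hasDerivAt u)

/-- The exponentials `exp (u x + (u² + 2 u) y)`, for distinct pairs `(x, y)`, are linearly
independent over the polynomials in `u`. The operator `d/du` minus the logarithmic derivative of
one exponential lowers the degree of the coefficient of that one and is injective on the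
coefficients of the others. -/
lemma eq_zero_of_sum_mul_exp_weightPoly (s : Finset (ℂ_[p] × ℂ_[p])) :
    ∀ R : ℂ_[p] × ℂ_[p] → ℂ_[p][X],
    (∀ᶠ u in nhds (0 : ℂ_[p]),
      ∑ q ∈ s, (R q).eval u * NormedSpace.exp ((weightPoly q).eval u) = 0) →
    ∀ q ∈ s, R q = 0 := by
  classical
  induction s using Finset.induction_on with
  | empty => simp
  | insert q₀ s hq₀ ih =>
    have key : ∀ k : ℕ, ∀ R : ℂ_[p] × ℂ_[p] → ℂ_[p][X], derivative^[k] (R q₀) = 0 →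
        (∀ᶠ u in nhds (0 : ℂ_[p]), ∑ q ∈ insert q₀ s,
          (R q).eval u * NormedSpace.exp ((weightPoly q).eval u) = 0) → ∀ q ∈ s, R q = 0 := by
      intro k
      induction k with
      | zero =>
        intro R hR h
        refine ih R (h.mono fun u hu => ?_)
        rw [Finset.sum_insert hq₀, show R q₀ = 0 from hR, eval_zero, zero_mul, zero_add] at hu
        exact hu
      | succ k ihk =>
        intro R hR h
        -- `T` has the coefficients of the derivative of the sum, minus the logarithmic derivative
        -- of the `q₀`-th exponential times the sum.
        let T : ℂ_[p] × ℂ_[p] → ℂ_[p][X] := fun q => derivative (R q) +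
          (derivative (weightPoly q) - derivative (weightPoly q₀)) * R q
        have hT0 : T q₀ = derivative (R q₀) := by simp [T]
        have hT : ∀ q ∈ s, T q = 0 := by
          refine ihk T (by rw [hT0]; exact hR) ?_
          have hd : ∀ᶠ u in nhds (0 : ℂ_[p]), ∀ q ∈ insert q₀ s,
              HasDerivAt (fun u => NormedSpace.exp ((weightPoly q).eval u))
              (NormedSpace.exp ((weightPoly q).eval u) * (derivative (weightPoly q)).eval u) u :=
            (Filter.eventually_all_finset _).2 fun q _ => eventually_hasDerivAt_exp_weightPoly q
          filter_upwards [hd, h, h.eventually_nhds] with u hu h0 h1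
          have h2 : HasDerivAt (fun u => ∑ q ∈ insert q₀ s,
              (R q).eval u * NormedSpace.exp ((weightPoly q).eval u))
              (∑ q ∈ insert q₀ s, ((derivative (R q)).eval u *
                NormedSpace.exp ((weightPoly q).eval u) + (R q).eval u *
                (NormedSpace.exp ((weightPoly q).eval u) *
                  (derivative (weightPoly q)).eval u))) u :=
            HasDerivAt.fun_sum fun q hq => ((R q).hasDerivAt u).mul (hu q hq)
          have h3 := h2.unique ((hasDerivAt_const u (0 : ℂ_[p])).congr_of_eventuallyEq h1)
          have h4 : ∑ q ∈ insert q₀ s, (T q).eval u * NormedSpace.exp ((weightPoly q).eval u) =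
              ∑ q ∈ insert q₀ s, ((derivative (R q)).eval u *
                NormedSpace.exp ((weightPoly q).eval u) + (R q).eval u *
                (NormedSpace.exp ((weightPoly q).eval u) * (derivative (weightPoly q)).eval u)) -
              (derivative (weightPoly q₀)).eval u * ∑ q ∈ insert q₀ s,
                (R q).eval u * NormedSpace.exp ((weightPoly q).eval u) := by
            rw [Finset.mul_sum, ← Finset.sum_sub_distrib]
            refine Finset.sum_congr rfl fun q _ => ?_
            simp only [T, eval_add, eval_mul, eval_sub]
            ring
          rw [h4, h3, h0, mul_zero, sub_zero]
        intro q hq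
        refine Polynomial.eq_zero_of_derivative_add_mul_eq_zero (sub_ne_zero.2
          (derivative_weightPoly_ne ?_)) (hT q hq)
        rintro rfl
        exact hq₀ hq
    intro R h
    have hs : ∀ q ∈ s, R q = 0 := key ((R q₀).natDegree + 1) R
      (iterate_derivative_eq_zero (Nat.lt_succ_self _)) h
    have hR0 : R q₀ = 0 := by
      have hev : ∀ᶠ u in nhds (0 : ℂ_[p]), (R q₀).eval u = 0 := by
        have hne : ∀ᶠ u in nhds (0 : ℂ_[p]), NormedSpace.exp ((weightPoly q₀).eval u) ≠ 0 := by
          have hc := (eventually_hasDerivAt_exp_weightPoly q₀).self_of_nhds.continuousAt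
          refine hc.eventually_ne ?_
          rw [eval_weightPoly, show (0 : ℂ_[p]) * q₀.1 + (0 ^ 2 + 2 * 0) * q₀.2 = 0 by ring,
            NormedSpace.exp_zero]
          exact one_ne_zero
        filter_upwards [h, hne] with u hu hne
        rw [Finset.sum_insert hq₀, Finset.sum_eq_zero (fun q hq => by rw [hs q hq, eval_zero,
          zero_mul]), add_zero] at hu
        exact (mul_eq_zero.1 hu).resolve_right hne
      refine Polynomial.eq_zero_of_infinite_isRoot _ (Set.Infinite.mono (fun u hu => hu) ?_)
      exact infinite_of_mem_nhds (0 : ℂ_[p]) hev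
    intro q hq
    rcases Finset.mem_insert.1 hq with rfl | hq
    · exact hR0
    · exact hs q hq

/-- A linear combination of the exponentials `exp (u x + (u² + 2 u) y)` with zeros accumulating
at `0` is trivial: it is analytic, so it vanishes near `0`, and the exponentials are independent. -/
theorem eq_zero_of_frequently_sum_exp_weightPoly (s : Finset (ℂ_[p] × ℂ_[p]))
    (c : ℂ_[p] × ℂ_[p] → ℂ_[p])
    (h : ∃ᶠ u in nhdsWithin (0 : ℂ_[p]) {0}ᶜ,
      ∑ q ∈ s, c q * NormedSpace.exp ((weightPoly q).eval u) = 0) :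
    ∀ q ∈ s, c q = 0 := by
  have han : AnalyticAt ℂ_[p]
      (fun u => ∑ q ∈ s, c q * NormedSpace.exp ((weightPoly q).eval u)) 0 := by
    refine Finset.analyticAt_fun_sum _ fun q _ => analyticAt_const.mul ?_
    have h1 : AnalyticAt ℂ_[p] (fun u => (weightPoly q).eval u) 0 := by
      simp only [eval_weightPoly]
      fun_prop
    refine AnalyticAt.comp ?_ h1
    have h2 : (weightPoly q).eval 0 = 0 := by rw [eval_weightPoly]; ring
    rw [h2]
    exact NormedSpace.analyticAt_exp_of_mem_ball 0
      (Metric.mem_eball_self (PadicComplex.expSeries_radius_pos p))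
  have h1 := han.frequently_zero_iff_eventually_zero.1 h
  have h2 := eq_zero_of_sum_mul_exp_weightPoly s (fun q => C (c q)) (by simpa using h1)
  exact fun q hq => C_eq_zero.1 (h2 q hq)

end Independence

/-! ### Powers of `σ` acting on a character -/

section Dynamics

variable {p : ℕ} [Fact p.Prime] {Γ : Type u} [CommGroup Γ]

/-- Some positive power of `σ` acts trivially modulo a given open subgroup: modulo that subgroup,
the powers of `σ` are determined by the images of finitely many generators. -/
lemma ProfComp.exists_iterate_div_mem [Group.FG Γ] (σ : ProfComp Γ ≃ₜ* ProfComp Γ)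
    (U : Subgroup (ProfComp Γ)) (hU : IsOpen (U : Set (ProfComp Γ))) :
    ∃ n : ℕ, 0 < n ∧ ∀ k g, σ^[n * k] g / g ∈ U := by
  obtain ⟨S, hS⟩ := Group.fg_def.1 (inferInstance : Group.FG Γ)
  have hfin : Finite (ProfComp Γ ⧸ U) := Subgroup.quotient_finite_of_isOpen U hU
  let it : ℕ → ProfComp Γ →* ProfComp Γ := fun n =>
    { toFun := σ^[n]
      map_one' := iterate_map_one σ n
      map_mul' := iterate_map_mul σ n }
  let F : ℕ → S → ProfComp Γ ⧸ U := fun n γ => QuotientGroup.mk (σ^[n] (eta Γ γ))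
  obtain ⟨a, b, hab, hF⟩ := Finite.exists_ne_map_eq_of_infinite F
  wlog hlt : a < b generalizing a b
  · exact this b a hab.symm hF.symm (lt_of_le_of_ne (not_lt.1 hlt) hab.symm)
  have hΓ : ∀ γ, σ^[b] (eta Γ γ) / σ^[a] (eta Γ γ) ∈ U := by
    have hle : Subgroup.closure (S : Set Γ) ≤ U.comap (((it b) / (it a)).comp (eta Γ)) := by
      rw [Subgroup.closure_le]
      intro γ hγ
      have := QuotientGroup.eq.1 (congrFun hF ⟨γ, hγ⟩)
      change σ^[b] (eta Γ γ) / σ^[a] (eta Γ γ) ∈ U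
      rwa [div_eq_inv_mul]
    rw [hS] at hle
    exact fun γ => hle (Subgroup.mem_top γ)
  have hcont : ∀ n, Continuous (σ^[n]) := fun n => σ.continuous_toFun.iterate n
  have hall : ∀ g, σ^[b] g / σ^[a] g ∈ U := by
    intro g
    have hcl : IsClosed {g | σ^[b] g / σ^[a] g ∈ U} :=
      (U.isClosed_of_isOpen hU).preimage ((hcont b).div' (hcont a))
    exact (denseRange_eta Γ).induction_on g hcl hΓ
  have h1 : ∀ g, σ^[b - a] g / g ∈ U := by
    intro g
    obtain ⟨g, rfl⟩ := (σ.surjective.iterate a) g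
    have := hall g
    rwa [← Nat.sub_add_cancel hlt.le, Function.iterate_add_apply] at this
  refine ⟨b - a, Nat.sub_pos_of_lt hlt, fun k => ?_⟩
  induction k with
  | zero => intro g; simp
  | succ k ih =>
    intro g
    rw [Nat.mul_succ, Function.iterate_add_apply,
      ← div_mul_div_cancel _ (σ^[b - a] g)]
    exact U.mul_mem (ih _) (h1 g)

/-- Euler's theorem modulo `p ^ k`. -/
lemma PadicInt.exists_pow_sub_one_norm_le (β : ℤ_[p]ˣ) (k : ℕ) :
    ∃ m : ℕ, 0 < m ∧ ‖(β : ℤ_[p]) ^ m - 1‖ ≤ (p : ℝ) ^ (-k : ℤ) := by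
  refine ⟨(p ^ k).totient, Nat.totient_pos.2 (pow_pos (Fact.out : p.Prime).pos k), ?_⟩
  rw [PadicInt.norm_le_pow_iff_mem_span_pow, ← PadicInt.ker_toZModPow, RingHom.mem_ker, map_sub,
    map_pow, map_one, sub_eq_zero]
  exact congrArg Units.val
    (ZMod.pow_totient (Units.map (PadicInt.toZModPow (p := p) k : ℤ_[p] →* ZMod (p ^ k)) β))

variable {V : Type*} [AddCommGroup V] [Module ℚ_[p] V]

/-- The solutions of the linear recurrence with characteristic roots `a` and `a²`. -/
lemma iterate_eq_of_quadratic_relation {X : Type*} (σ : X → X) (ℓ : X → V) {a : ℚ_[p]}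
    (h : ∀ g, ℓ (σ (σ g)) - a ^ 2 • ℓ (σ g) = a • (ℓ (σ g) - a ^ 2 • ℓ g)) (n : ℕ) (g : X) :
    (a - a ^ 2) • ℓ (σ^[n] g) =
      a ^ n • (ℓ (σ g) - a ^ 2 • ℓ g) - (a ^ n) ^ 2 • (ℓ (σ g) - a • ℓ g) := by
  have h1 : ∀ n g, ℓ (σ (σ^[n] g)) - a ^ 2 • ℓ (σ^[n] g) = a ^ n • (ℓ (σ g) - a ^ 2 • ℓ g) := by
    intro n
    induction n with
    | zero => intro g; simp
    | succ n ih =>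
      intro g
      rw [Function.iterate_succ_apply', h, ih, smul_smul, ← pow_succ']
  have h2 : ∀ n g, ℓ (σ (σ^[n] g)) - a • ℓ (σ^[n] g) = (a ^ n) ^ 2 • (ℓ (σ g) - a • ℓ g) := by
    intro n
    induction n with
    | zero => intro g; simp
    | succ n ih =>
      intro g
      have h3 : ∀ g, ℓ (σ (σ g)) - a • ℓ (σ g) = a ^ 2 • (ℓ (σ g) - a • ℓ g) := by
        intro g
        have := h g
        have h4 : ℓ (σ (σ g)) = a • (ℓ (σ g) - a ^ 2 • ℓ g) + a ^ 2 • ℓ (σ g) :=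
          eq_add_of_sub_eq this
        rw [h4]
        module
      rw [Function.iterate_succ_apply', h3, ih, smul_smul, pow_succ a n]
      congr 1
      ring
  rw [← h1, ← h2]
  module

/-- Along the powers of `σ` acting trivially modulo a small open subgroup, a continuous character
moves along the curve `u ↦ exp (u x + (u² + 2 u) y)`, where `x` and `y` are the components of
weights one and two of its logarithm. -/
theorem ActsWithWeights.exists_weights [Group.FG Γ] {N : Subgroup Γ}
    {σ : ProfComp Γ ≃ₜ* ProfComp Γ} {α : ℤ_[p]ˣ} (hσ : ActsWithWeights p N σ α)
    (χ : ContChar p Γ) :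
    ∃ (w : Γ →* Multiplicative (ℂ_[p] × ℂ_[p])),
      (∀ γ, w γ = 1 → ∃ m : ℕ, 0 < m ∧ χ.toHom (ProfComp.eta Γ γ) ^ m = 1) ∧
      ∃ n : ℕ, 0 < n ∧ ∀ k γ,
        ((χ.toHom (σ^[n * k] (ProfComp.eta Γ γ)) : PadicAlgCl p) : ℂ_[p]) =
        ((χ.toHom (ProfComp.eta Γ γ) : PadicAlgCl p) : ℂ_[p]) * NormedSpace.exp
          ((weightPoly (w γ).toAdd).eval
            (algebraMap ℚ_[p] ℂ_[p] (((α⁻¹ : ℤ_[p]ˣ) : ℤ_[p]) ^ (n * k) - 1 : ℤ_[p]))) := by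
  obtain ⟨a, ha⟩ : ∃ a : ℚ_[p], a = (((α⁻¹ : ℤ_[p]ˣ) : ℤ_[p]) : ℚ_[p]) := ⟨_, rfl⟩
  have ha0 : a ≠ 0 := by
    rw [ha]
    simp
  have ha1 : a ≠ 1 := by
    intro h
    refine hσ.not_root_of_unity 1 one_pos ?_
    rw [ha, ← PadicInt.coe_one] at h
    have h1 : ((α⁻¹ : ℤ_[p]ˣ) : ℤ_[p]) = 1 := Subtype.ext h
    have h := Units.val_eq_one.1 h1
    rw [pow_one, ← inv_inv α, h, inv_one]
  have had : a - a ^ 2 ≠ 0 := by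
    rw [show a - a ^ 2 = a * (1 - a) by ring]
    exact mul_ne_zero ha0 (sub_ne_zero.2 ha1.symm)
  let X : ProfComp Γ →* ℂ_[p] :=
    ((algebraMap (PadicAlgCl p) ℂ_[p] : PadicAlgCl p →* ℂ_[p]).comp
      (Units.coeHom (PadicAlgCl p))).comp χ.toHom
  have hXdef : ∀ g, X g = ((χ.toHom g : PadicAlgCl p) : ℂ_[p]) := fun g => rfl
  have hX : Continuous X :=
    (UniformSpace.Completion.continuous_coe _).comp (Units.continuous_val.comp χ.continuous_toHom)
  obtain ⟨ℓ, U, hℓ, hU, hℓ1, hℓU⟩ := exists_log_char X hX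
  obtain ⟨n, hn, hnU⟩ := ProfComp.exists_iterate_div_mem σ U hU
  have hquad := hσ.quadratic_relation (V := ℂ_[p]) ℓ hℓ ha
  obtain ⟨A, hA⟩ : ∃ A : ℂ_[p], A = algebraMap ℚ_[p] ℂ_[p] a := ⟨_, rfl⟩
  have hAd : A - A ^ 2 ≠ 0 := by
    rw [hA, ← map_pow, ← map_sub]
    exact (map_ne_zero _).2 had
  have hiter : ∀ t g, (A - A ^ 2) * (ℓ (σ^[t] g)).toAdd =
      A ^ t * ((ℓ (σ g)).toAdd - A ^ 2 * (ℓ g).toAdd) -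
        (A ^ t) ^ 2 * ((ℓ (σ g)).toAdd - A * (ℓ g).toAdd) := by
    intro t g
    have := iterate_eq_of_quadratic_relation σ (fun g => (ℓ g).toAdd) hquad t g
    simpa only [Algebra.smul_def, map_sub, map_pow, ← hA] using this
  -- The decomposition `ℓ = x + y` into the components on which `σ` acts by `A` and by `A ^ 2`.
  let x : ProfComp Γ → ℂ_[p] := fun g => (A - A ^ 2)⁻¹ * ((ℓ (σ g)).toAdd - A ^ 2 * (ℓ g).toAdd)
  let y : ProfComp Γ → ℂ_[p] := fun g => -((A - A ^ 2)⁻¹ * ((ℓ (σ g)).toAdd - A * (ℓ g).toAdd))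
  have hx : ∀ g h, x (g * h) = x g + x h := by
    intro g h
    simp only [x, map_mul, toAdd_mul]
    ring
  have hy : ∀ g h, y (g * h) = y g + y h := by
    intro g h
    simp only [y, map_mul, toAdd_mul]
    ring
  have hxy : ∀ g, x g + y g = (ℓ g).toAdd := by
    intro g
    have : x g + y g = (A - A ^ 2)⁻¹ * (A - A ^ 2) * (ℓ g).toAdd := by
      simp only [x, y]
      ring
    rw [this, inv_mul_cancel₀ hAd, one_mul]
  let w : Γ →* Multiplicative (ℂ_[p] × ℂ_[p]) := MonoidHom.mk'
    (fun γ => Multiplicative.ofAdd (x (ProfComp.eta Γ γ), y (ProfComp.eta Γ γ))) (fun γ δ => by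
      rw [map_mul, hx, hy, ← Prod.mk_add_mk, ofAdd_add])
  refine ⟨w, fun γ hγ => ?_, n, hn, fun k γ => ?_⟩
  · have h1 : (x (ProfComp.eta Γ γ), y (ProfComp.eta Γ γ)) = ((0, 0) : ℂ_[p] × ℂ_[p]) := hγ
    rw [Prod.mk.injEq] at h1
    have h2 : ℓ (ProfComp.eta Γ γ) = 1 := by
      have := hxy (ProfComp.eta Γ γ)
      rw [h1.1, h1.2, add_zero] at this
      exact this.symm
    obtain ⟨m, hm, hXm⟩ := hℓ1 _ h2
    refine ⟨m, hm, Units.ext ?_⟩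
    rw [← map_pow, hXdef, map_pow, ← UniformSpace.Completion.coe_one] at hXm
    exact UniformSpace.Completion.coe_injective _ hXm
  · rw [← hXdef, ← hXdef]
    have hw : (w γ).toAdd = (x (ProfComp.eta Γ γ), y (ProfComp.eta Γ γ)) := rfl
    rw [hw]
    generalize ProfComp.eta Γ γ = g
    have hu : algebraMap ℚ_[p] ℂ_[p] ((((α⁻¹ : ℤ_[p]ˣ) : ℤ_[p]) ^ (n * k) - 1 : ℤ_[p]) : ℚ_[p]) =
        A ^ (n * k) - 1 := by
      rw [PadicInt.coe_sub, PadicInt.coe_pow, PadicInt.coe_one, ← ha, map_sub, map_pow, map_one, hA]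
    rw [hu, eval_weightPoly]
    have h1 : X (σ^[n * k] g) = X g * X (σ^[n * k] g / g) := by
      rw [← map_mul, mul_div_cancel]
    rw [h1, hℓU _ (hnU k g)]
    congr 2
    rw [map_div, toAdd_div, ← hxy g]
    have h2 : (ℓ (σ^[n * k] g)).toAdd = A ^ (n * k) * x g + (A ^ (n * k)) ^ 2 * y g := by
      have h3 := congrArg (fun z => (A - A ^ 2)⁻¹ * z) (hiter (n * k) g)
      simp only [inv_mul_cancel_left₀ hAd] at h3
      rw [h3]
      simp only [x, y]
      ring
    rw [h2]
    ring

end Dynamics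

/-! ### Cosets of subtori and their torsion points -/

section Coset

variable {K : Type} [Field K] {Γ : Type u} [CommGroup Γ] {M : Type*} [CommGroup M]

/-- The homomorphism `K[Γ] → K[M]`, `γ ↦ χ(γ) [π(γ)]`. When `π` is surjective, its kernel is the
ideal of the coset `χ · Hom(M, Kˣ)` in the character variety of `Γ`. -/
noncomputable def cosetMap (χ : Γ →* Kˣ) (π : Γ →* M) :
    MonoidAlgebra K Γ →ₐ[K] MonoidAlgebra K M :=
  MonoidAlgebra.lift K (MonoidAlgebra K M) Γ
    { toFun := fun γ => MonoidAlgebra.single (π γ) (χ γ : K)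
      map_one' := by rw [map_one, map_one, Units.val_one]; rfl
      map_mul' := fun γ δ => by
        rw [map_mul, map_mul, Units.val_mul, MonoidAlgebra.single_mul_single] }

lemma cosetMap_single (χ : Γ →* Kˣ) (π : Γ →* M) (γ : Γ) (c : K) :
    cosetMap χ π (MonoidAlgebra.single γ c) = MonoidAlgebra.single (π γ) (c * χ γ) := by
  simp [cosetMap]

/-- Evaluating at a character of the form `γ ↦ χ(γ) κ(π(γ))` only depends on `cosetMap χ π`. -/
lemma algebraMap_evalChar_eq_sum {A : Type*} [CommRing A] [Algebra K A] {χ ψ : Γ →* Kˣ}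
    {π : Γ →* M} (κ : M → A)
    (h : ∀ γ, algebraMap K A (ψ γ) = algebraMap K A (χ γ) * κ (π γ)) (f : MonoidAlgebra K Γ) :
    algebraMap K A (evalChar ψ f) =
      (cosetMap χ π f).coeff.sum fun m c => algebraMap K A c * κ m := by
  induction f using MonoidAlgebra.induction_linear with
  | zero => simp
  | add f g hf hg =>
    rw [map_add, map_add, map_add, MonoidAlgebra.coeff_add, Finsupp.sum_add_index', hf, hg]
    · intro m; rw [map_zero, zero_mul]
    · intro m a b; rw [map_add, add_mul]
  | single γ c =>
    rw [cosetMap_single, evalChar_single, MonoidAlgebra.coeff_single, Finsupp.sum_single_index,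
      map_mul, map_mul, h, mul_assoc]
    rw [map_zero, zero_mul]

lemma evalChar_eq_zero_of_cosetMap_eq_zero {χ ψ : Γ →* Kˣ} {π : Γ →* M} (κ : M → K)
    (h : ∀ γ, (ψ γ : K) = χ γ * κ (π γ)) {f : MonoidAlgebra K Γ} (hf : cosetMap χ π f = 0) :
    evalChar ψ f = 0 := by
  have := algebraMap_evalChar_eq_sum (A := K) κ h f
  rwa [hf, MonoidAlgebra.coeff_zero, Finsupp.sum_zero_index] at this

end Coset

section Torsion

lemma isOfFinOrder_monoidHom {Γ H : Type*} [CommGroup Γ] [Group.FG Γ] [CommGroup H] (ψ : Γ →* H)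
    (h : ∀ γ, IsOfFinOrder (ψ γ)) : IsOfFinOrder ψ := by
  obtain ⟨S, hS⟩ := Group.fg_def.1 (inferInstance : Group.FG Γ)
  refine isOfFinOrder_iff_pow_eq_one.2 ⟨∏ γ ∈ S, orderOf (ψ γ),
    Finset.prod_pos fun γ _ => (h γ).orderOf_pos, ?_⟩
  refine MonoidHom.eq_of_eqOn_dense hS fun γ hγ => ?_
  rw [MonoidHom.pow_apply, MonoidHom.one_apply]
  exact orderOf_dvd_iff_pow_eq_one.1 (Finset.dvd_prod_of_mem _ hγ)

/-- Characters of finite order separate the points of a finitely generated torsion-free group. -/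
lemma exists_isOfFinOrder_apply_ne_one {M : Type*} [CommGroup M] [IsMulTorsionFree M]
    [Module.Finite ℤ (Additive M)] (K : Type*) [Field K] [CharZero K] [IsAlgClosed K]
    {m : M} (hm : m ≠ 1) : ∃ τ : M →* Kˣ, IsOfFinOrder τ ∧ τ m ≠ 1 := by
  let b := Module.Free.chooseBasis ℤ (Additive M)
  obtain ⟨i, hi⟩ : ∃ i, b.repr (Additive.ofMul m) i ≠ 0 := by
    by_contra! h
    exact hm (Additive.ofMul.injective (b.repr.map_eq_zero_iff.1 (Finsupp.ext h)))
  set z := b.repr (Additive.ofMul m) i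
  -- A root of unity of order larger than `|z|` has nontrivial `z`-th power.
  obtain ⟨ζ₀, hζ₀⟩ := HasEnoughRootsOfUnity.exists_primitiveRoot K (z.natAbs + 1)
  obtain ⟨ζ, rfl⟩ := hζ₀.isUnit (Nat.succ_ne_zero _)
  have hζ : IsPrimitiveRoot ζ (z.natAbs + 1) := IsPrimitiveRoot.coe_units_iff.1 hζ₀
  let τ : M →* Kˣ :=
    { toFun := fun m => ζ ^ (b.repr (Additive.ofMul m) i)
      map_one' := by simp
      map_mul' := fun x y => by
        rw [ofMul_mul, map_add, Finsupp.add_apply, zpow_add] }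
  refine ⟨τ, isOfFinOrder_iff_pow_eq_one.2 ⟨z.natAbs + 1, Nat.succ_pos _, ?_⟩, fun h => ?_⟩
  · ext x
    rw [MonoidHom.pow_apply]
    change ((ζ ^ (b.repr (Additive.ofMul x) i)) ^ (z.natAbs + 1) : Kˣ).val = 1
    rw [← zpow_natCast, ← zpow_mul, mul_comm, zpow_mul, zpow_natCast, hζ.pow_eq_one, one_zpow,
      Units.val_one]
  · have h1 : ζ ^ z = 1 := h
    rw [hζ.zpow_eq_one_iff_dvd] at h1
    have h2 := Int.natAbs_dvd_natAbs.2 h1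
    have h3 := Nat.le_of_dvd (Int.natAbs_pos.2 hi) h2
    have h4 : ((z.natAbs + 1 : ℕ) : ℤ).natAbs = z.natAbs + 1 := Int.natAbs_natCast _
    omega

/-- Torsion points are dense in a coset of a subtorus on which some character has finite order. The
coset is moved to the identity by such a character, and on the subtorus the claim is Dedekind's
independence, applied to the evaluations of the characters of finite order. -/
theorem exists_torsion_evalChar_ne_zero {K : Type} [Field K] [CharZero K] [IsAlgClosed K]
    {Γ : Type u} [CommGroup Γ] [Group.FG Γ] {M : Type*} [CommGroup M] [IsMulTorsionFree M]
    (χ : Γ →* Kˣ) (π : Γ →* M) (hπ : Function.Surjective π)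
    (hχ : ∀ γ, π γ = 1 → ∃ m : ℕ, 0 < m ∧ χ γ ^ m = 1)
    {f : MonoidAlgebra K Γ} (hf : cosetMap χ π f ≠ 0) :
    ∃ ψ : Γ →* Kˣ, IsOfFinOrder ψ ∧ (∀ f', cosetMap χ π f' = 0 → evalChar ψ f' = 0) ∧
      evalChar ψ f ≠ 0 := by
  let πadd : Additive Γ →ₗ[ℤ] Additive M := π.toAdditive.toIntLinearMap
  have hπadd : Function.Surjective πadd := hπ
  have : Module.Finite ℤ (Additive M) := Module.Finite.of_surjective πadd hπadd
  -- A section of `π`, since `M` is free.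
  obtain ⟨s', hs'⟩ := Module.projective_lifting_property πadd LinearMap.id hπadd
  let s : M →* Γ := AddMonoidHom.toMultiplicative s'.toAddMonoidHom
  have hs : ∀ m, π (s m) = m := fun m => LinearMap.congr_fun hs' m
  let T := CommGroup.torsion (M →* Kˣ)
  let ev : M → (T →* K) := fun m =>
    { toFun := fun τ => ((τ : M →* Kˣ) m : K)
      map_one' := rfl
      map_mul' := fun _ _ => rfl }
  have hev : Function.Injective ev := by
    intro a b hab
    by_contra hne
    obtain ⟨τ, hτ, hτab⟩ :=
      exists_isOfFinOrder_apply_ne_one K (m := a / b) (by rwa [Ne, div_eq_one])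
    have h1 : (τ a : K) = τ b := congrArg (fun e : T →* K => e ⟨τ, hτ⟩) hab
    exact hτab (by rw [map_div, Units.ext h1, div_self'])
  -- The character `χ / (χ ∘ s ∘ π)` has finite order, since it takes roots of unity as values.
  let ψ : T → (Γ →* Kˣ) := fun τ => χ * (χ.comp (s.comp π))⁻¹ * (τ : M →* Kˣ).comp π
  let κ : T → M → K := fun τ m => ((χ (s m))⁻¹ : Kˣ) * ((τ : M →* Kˣ) m : K)
  have hψκ : ∀ τ γ, (ψ τ γ : K) = χ γ * κ τ (π γ) := by
    intro τ γ
    simp only [ψ, κ, MonoidHom.mul_apply, MonoidHom.inv_apply, MonoidHom.comp_apply, Units.val_mul,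
      mul_assoc]
  have hfin : ∀ τ, IsOfFinOrder (ψ τ) := by
    intro τ
    refine isOfFinOrder_monoidHom _ fun γ => ?_
    have h1 : IsOfFinOrder (χ (γ / s (π γ))) :=
      isOfFinOrder_iff_pow_eq_one.2 (hχ _ (by rw [map_div, hs, div_self']))
    have h2 : IsOfFinOrder ((τ : M →* Kˣ) (π γ)) := by
      obtain ⟨n, hn, h⟩ := isOfFinOrder_iff_pow_eq_one.1 τ.2
      exact isOfFinOrder_iff_pow_eq_one.2 ⟨n, hn, by rw [← MonoidHom.pow_apply, h]; rfl⟩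
    have h3 : ψ τ γ = χ (γ / s (π γ)) * (τ : M →* Kˣ) (π γ) := by
      rw [map_div, div_eq_mul_inv]
      rfl
    rw [h3]
    exact h1.mul h2
  by_contra! hcon
  have hzero : ∀ τ, evalChar (ψ τ) f = 0 := fun τ => hcon (ψ τ) (hfin τ)
    fun f' hf' => evalChar_eq_zero_of_cosetMap_eq_zero (κ τ) (hψκ τ) hf'
  have hli : LinearIndependent K (fun m => (ev m : T → K)) :=
    (linearIndependent_monoidHom T K).comp ev hev
  have h0 := linearIndependent_iff'.1 hli (cosetMap χ π f).coeff.support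
    (fun m => (cosetMap χ π f).coeff m * ((χ (s m))⁻¹ : Kˣ)) (by
      ext τ
      have := algebraMap_evalChar_eq_sum (A := K) (χ := χ) (ψ := ψ τ) (κ τ) (hψκ τ) f
      rw [hzero τ, map_zero, Finsupp.sum] at this
      rw [Finset.sum_apply, Pi.zero_apply, this]
      refine Finset.sum_congr rfl fun m _ => ?_
      exact mul_assoc _ _ _)
  refine hf (MonoidAlgebra.coeff_injective (Finsupp.ext fun m => ?_))
  by_contra hm
  exact (mul_ne_zero hm (Units.ne_zero _)) (h0 m (Finsupp.mem_support_iff.2 hm))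

end Torsion

/-! ### Stable closed sets and their components -/

section Stable

variable {p : ℕ} [Fact p.Prime] {Γ : Type u} [CommGroup Γ]

lemma exists_contChar_iterate {S : Set (CharVariety Γ (PadicAlgCl p))}
    {σ : ProfComp Γ ≃ₜ* ProfComp Γ}
    (hstab : ∀ χ : ContChar p Γ, phi χ ∈ S → phi (χ.act σ) ∈ S) {χ : ContChar p Γ}
    (hχ : phi χ ∈ S) (k : ℕ) :
    ∃ χ' : ContChar p Γ, phi χ' ∈ S ∧ ∀ g, χ'.toHom g = χ.toHom (σ^[k] g) := by
  induction k with
  | zero => exact ⟨χ, hχ, fun g => rfl⟩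
  | succ k ih =>
    obtain ⟨χ', h, h'⟩ := ih
    exact ⟨χ'.act σ, hstab χ' h, fun g => h' (σ g)⟩

/-- The powers of a unit of `ℤ_[p]` accumulate at `1`, without reaching it when the unit is not a
root of unity. -/
lemma exists_tendsto_pow_sub_one (β : ℤ_[p]ˣ) (hβ : ∀ n : ℕ, 0 < n → β ^ n ≠ 1) {n : ℕ}
    (hn : 0 < n) :
    ∃ m : ℕ → ℕ, Filter.Tendsto
      (fun k => algebraMap ℚ_[p] ℂ_[p] ((β : ℤ_[p]) ^ (n * m k) - 1 : ℤ_[p])) Filter.atTop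
      (nhdsWithin 0 {0}ᶜ) := by
  choose m hm0 hm using fun k => PadicInt.exists_pow_sub_one_norm_le (β ^ n) k
  refine ⟨m, tendsto_nhdsWithin_iff.2 ⟨?_, Filter.Eventually.of_forall fun k h => ?_⟩⟩
  · rw [tendsto_zero_iff_norm_tendsto_zero]
    have h0 : Filter.Tendsto (fun k : ℕ => (p : ℝ) ^ (-k : ℤ)) Filter.atTop (nhds 0) := by
      have hp : (1 : ℝ) < p := by exact_mod_cast (Fact.out : p.Prime).one_lt
      have := tendsto_pow_atTop_nhds_zero_of_lt_one (inv_nonneg.2 (zero_le_one.trans hp.le))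
        (inv_lt_one_of_one_lt₀ hp)
      simpa using this
    refine squeeze_zero (fun _ => norm_nonneg _) (fun k => ?_) h0
    rw [norm_algebraMap', ← PadicInt.norm_def, pow_mul]
    simpa using hm k
  · rw [Set.mem_singleton_iff, map_eq_zero_iff _ (algebraMap ℚ_[p] ℂ_[p]).injective] at h
    have h1 : (β : ℤ_[p]) ^ (n * m k) = 1 := sub_eq_zero.1 (Subtype.ext h)
    refine hβ (n * m k) (Nat.mul_pos hn (hm0 k)) (Units.ext ?_)
    rw [Units.val_pow_eq_pow_val, h1, Units.val_one]

/-- If a `σ`-stable set `S` contains the point of a continuous character `χ`, its closure contains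
the coset by `χ` of the subtorus of the characters that factor through `w`. As `χ` takes roots of
unity as values on the kernel of `w`, this coset meets the torsion points. -/
theorem ActsWithWeights.exists_coset [Group.FG Γ] {N : Subgroup Γ}
    {σ : ProfComp Γ ≃ₜ* ProfComp Γ} {α : ℤ_[p]ˣ} (hσ : ActsWithWeights p N σ α)
    {S : Set (CharVariety Γ (PadicAlgCl p))}
    (hstab : ∀ χ : ContChar p Γ, phi χ ∈ S → phi (χ.act σ) ∈ S) {χ : ContChar p Γ}
    (hχ : phi χ ∈ S) :
    ∃ w : Γ →* Multiplicative (ℂ_[p] × ℂ_[p]),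
      (∀ γ, w γ = 1 → ∃ m : ℕ, 0 < m ∧ χ.toHom (ProfComp.eta Γ γ) ^ m = 1) ∧
      ∀ f ∈ PrimeSpectrum.vanishingIdeal S,
        cosetMap (χ.toHom.comp (ProfComp.eta Γ)) w.rangeRestrict f = 0 := by
  obtain ⟨w, hw, n, hn, hwn⟩ := hσ.exists_weights χ
  refine ⟨w, hw, fun f hf => ?_⟩
  have hβ : ∀ n : ℕ, 0 < n → (α⁻¹) ^ n ≠ 1 := fun n hn h =>
    hσ.not_root_of_unity n hn (by rwa [inv_pow, inv_eq_one] at h)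
  obtain ⟨m, hm⟩ := exists_tendsto_pow_sub_one α⁻¹ hβ hn
  set F := cosetMap (χ.toHom.comp (ProfComp.eta Γ)) w.rangeRestrict f
  let v : w.range → ℂ_[p] × ℂ_[p] := fun q => (q : Multiplicative (ℂ_[p] × ℂ_[p])).toAdd
  have hv : Function.Injective v := fun a b h => Subtype.ext h
  -- The coefficients of `F`, as a function on the pairs of weights.
  let c : ℂ_[p] × ℂ_[p] → ℂ_[p] :=
    Function.extend v (fun q => algebraMap (PadicAlgCl p) ℂ_[p] (F.coeff q)) 0
  have hc : ∀ q, c (v q) = algebraMap (PadicAlgCl p) ℂ_[p] (F.coeff q) := fun q =>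
    hv.extend_apply _ _ q
  -- Evaluating `f` at the characters `χ ∘ σ ^ (n * m k)`, which lie in `S`.
  have hsum : ∀ k, ∑ q ∈ F.coeff.support.map ⟨v, hv⟩, c q * NormedSpace.exp ((weightPoly q).eval
      (algebraMap ℚ_[p] ℂ_[p] (((α⁻¹ : ℤ_[p]ˣ) : ℤ_[p]) ^ (n * m k) - 1 : ℤ_[p]))) = 0 := by
    intro k
    obtain ⟨χ', hχ', hχ'σ⟩ := exists_contChar_iterate hstab hχ (n * m k)
    have h0 : evalChar (χ'.toHom.comp (ProfComp.eta Γ)) f = 0 :=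
      (PrimeSpectrum.mem_vanishingIdeal _ _).1 hf _ hχ'
    have h1 := algebraMap_evalChar_eq_sum (A := ℂ_[p]) (χ := χ.toHom.comp (ProfComp.eta Γ))
      (ψ := χ'.toHom.comp (ProfComp.eta Γ)) (π := w.rangeRestrict)
      (fun q => NormedSpace.exp ((weightPoly (v q)).eval
        (algebraMap ℚ_[p] ℂ_[p] (((α⁻¹ : ℤ_[p]ˣ) : ℤ_[p]) ^ (n * m k) - 1 : ℤ_[p]))))
      (fun γ => by
        rw [MonoidHom.comp_apply, hχ'σ]
        exact hwn (m k) γ) f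
    rw [h0, map_zero] at h1
    rw [Finset.sum_map]
    refine Eq.trans (Finset.sum_congr rfl fun q _ => ?_) h1.symm
    change c (v q) * _ = _
    rw [hc]
    rfl
  have hzero := eq_zero_of_frequently_sum_exp_weightPoly (F.coeff.support.map ⟨v, hv⟩) c
    (hm.frequently (Filter.Frequently.of_forall hsum))
  refine MonoidAlgebra.coeff_injective (Finsupp.ext fun q => ?_)
  by_contra hq
  have h2 := hzero (v q) (Finset.mem_map_of_mem ⟨v, hv⟩ (Finsupp.mem_support_iff.2 hq))
  rw [hc, map_eq_zero_iff _ (algebraMap (PadicAlgCl p) ℂ_[p]).injective] at h2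
  exact hq h2

end Stable

section Components

lemma isIrreducible_preimage_val {X : Type*} [TopologicalSpace X] {S Z : Set X}
    (hZ : IsIrreducible Z) (hZS : Z ⊆ S) : IsIrreducible (Subtype.val ⁻¹' Z : Set S) := by
  have : IrreducibleSpace Z := Subtype.irreducibleSpace hZ
  have h := (IrreducibleSpace.isIrreducible_univ Z).image (Set.inclusion hZS)
    (continuous_inclusion hZS).continuousOn
  rwa [Set.image_univ, Set.range_inclusion] at h

/-- An irreducible component of a closed subset `S`, seen in the ambient spectrum, is closed and
corresponds to a minimal prime over the ideal of `S`. -/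
lemma PrimeSpectrum.vanishingIdeal_image_val_mem_minimalPrimes {R : Type*} [CommRing R]
    {S : Set (PrimeSpectrum R)} (hS : IsClosed S) {S' : Set S}
    (hS' : S' ∈ irreducibleComponents S) :
    IsClosed (Subtype.val '' S') ∧ vanishingIdeal (Subtype.val '' S') ∈
      (vanishingIdeal S).minimalPrimes := by
  have hcl : IsClosed (Subtype.val '' S') :=
    hS.isClosedEmbedding_subtypeVal.isClosedMap _ (isClosed_of_mem_irreducibleComponents S' hS')
  have hirr : IsIrreducible (Subtype.val '' S') :=
    hS'.1.image _ continuous_subtype_val.continuousOn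
  refine ⟨hcl, ⟨isIrreducible_iff_vanishingIdeal_isPrime.1 hirr,
    vanishingIdeal_anti_mono (Subtype.coe_image_subset S S')⟩, ?_⟩
  rintro Q ⟨hQ, hSQ⟩ hQP
  have hZirr : IsIrreducible (zeroLocus (Q : Set R)) := by
    rw [isIrreducible_zeroLocus_iff_of_radical _ hQ.isRadical]
    exact hQ
  have hZS : zeroLocus (Q : Set R) ⊆ S := by
    rw [← hS.closure_eq, ← zeroLocus_vanishingIdeal_eq_closure]
    exact zeroLocus_anti_mono hSQ
  have hle : S' ⊆ Subtype.val ⁻¹' zeroLocus (Q : Set R) := by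
    intro x hx
    have h1 : (x : PrimeSpectrum R) ∈ zeroLocus (vanishingIdeal (Subtype.val '' S') : Set R) :=
      subset_zeroLocus_vanishingIdeal _ ⟨x, hx, rfl⟩
    exact zeroLocus_anti_mono hQP h1
  have hge := hS'.2 (isIrreducible_preimage_val hZirr hZS) hle
  have hsub : zeroLocus (Q : Set R) ⊆ Subtype.val '' S' := fun x hx => ⟨⟨x, hZS hx⟩, hge hx, rfl⟩
  have := vanishingIdeal_anti_mono hsub
  rwa [vanishingIdeal_zeroLocus_eq_radical, hQ.isRadical.radical] at this

lemma Ideal.exists_mem_forall_minimalPrimes_ne {R : Type*} [CommRing R] [IsNoetherianRing R]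
    {I P : Ideal R} (hP : P ∈ I.minimalPrimes) :
    ∃ g ∉ P, ∀ Q ∈ I.minimalPrimes, Q ≠ P → g ∈ Q := by
  classical
  have : P.IsPrime := hP.1.1
  let s := (Ideal.finite_minimalPrimes_of_isNoetherianRing R I).toFinset.erase P
  have h : ¬ s.inf id ≤ P := by
    rw [Ideal.IsPrime.inf_le' this]
    rintro ⟨Q, hQ, hQP⟩
    obtain ⟨hne, hQ⟩ := Finset.mem_erase.1 hQ
    rw [Set.Finite.mem_toFinset] at hQ
    exact hne (le_antisymm hQP (hP.2 hQ.1 hQP))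
  obtain ⟨g, hg, hgP⟩ := SetLike.not_le_iff_exists.1 h
  refine ⟨g, hgP, fun Q hQ hne => ?_⟩
  exact (Finset.inf_le (f := id) (Finset.mem_erase.2 ⟨hne, by rwa [Set.Finite.mem_toFinset]⟩) :
    s.inf id ≤ Q) hg

end Components

theorem corollary4p3 {Γ : Type u} [CommGroup Γ] [Group.FG Γ] (N : Subgroup Γ)
    (p : ℕ) [Fact p.Prime] (σ : ProfComp Γ ≃ₜ* ProfComp Γ) (α : ℤ_[p]ˣ)
    (hσ : ActsWithWeights p N σ α)
    (S : Set (CharVariety Γ (PadicAlgCl p))) (hS : IsClosed S)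
    (hstab : ∀ χ : ContChar p Γ, phi χ ∈ S → phi (χ.act σ) ∈ S)
    (S' : Set S) (hS' : S' ∈ irreducibleComponents S)
    (hne : (phi (p := p) ⁻¹' (Subtype.val '' S')).Nonempty) :
    closure (Subtype.val '' S' ∩ torsionPoints Γ (PadicAlgCl p)) = Subtype.val '' S' := by
  obtain ⟨hcl, hP⟩ := PrimeSpectrum.vanishingIdeal_image_val_mem_minimalPrimes hS hS'
  have hFG : Monoid.FG Γ := Group.fg_iff_monoid_fg.1 inferInstance
  have hnoeth : IsNoetherianRing (MonoidAlgebra (PadicAlgCl p) Γ) :=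
    Algebra.FiniteType.isNoetherianRing (PadicAlgCl p) _
  set X : Set (CharVariety Γ (PadicAlgCl p)) := Subtype.val '' S'
  set P := PrimeSpectrum.vanishingIdeal X
  have hPp : P.IsPrime := hP.1.1
  have hXP : ∀ x : CharVariety Γ (PadicAlgCl p), P ≤ x.asIdeal → x ∈ X := by
    intro x hx
    rw [← hcl.closure_eq, ← PrimeSpectrum.zeroLocus_vanishingIdeal_eq_closure]
    exact hx
  refine subset_antisymm (closure_minimal Set.inter_subset_left hcl) ?_
  rw [← PrimeSpectrum.zeroLocus_vanishingIdeal_eq_closure]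
  suffices hle : PrimeSpectrum.vanishingIdeal (X ∩ torsionPoints Γ (PadicAlgCl p)) ≤ P by
    exact (PrimeSpectrum.subset_zeroLocus_vanishingIdeal X).trans
      (PrimeSpectrum.zeroLocus_anti_mono hle)
  intro f hf
  by_contra hfP
  -- `g` vanishes on every component other than `X`.
  obtain ⟨g, hgP, hg⟩ := Ideal.exists_mem_forall_minimalPrimes_ne hP
  have hgf : g * f ∉ P := fun h => (hPp.mem_or_mem h).elim hgP hfP
  obtain ⟨χ₀, hχ₀⟩ := hne
  have hPχ₀ : P ≤ (phi χ₀).asIdeal := fun a ha =>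
    (PrimeSpectrum.mem_vanishingIdeal _ _).1 ha _ hχ₀
  -- A continuous character on `X` outside the other components and outside the zeros of `f`.
  obtain ⟨χ, hPχ, hgfχ⟩ := exists_contChar_notMem P χ₀ hPχ₀ hgf
  have hχS : phi χ ∈ S := Subtype.coe_image_subset S S' (hXP _ hPχ)
  obtain ⟨w, hw, hwS⟩ := hσ.exists_coset hstab hχS
  -- The group algebra of the torsion-free group `w.range` is a domain, so the coset is irreducible.
  have hU : UniqueProds w.range :=
    UniqueProds.of_injective_mulHom
      (w.range.subtype : w.range →ₙ* Multiplicative (ℂ_[p] × ℂ_[p])) w.range.subtype_injective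
      inferInstance
  set Φ := cosetMap (χ.toHom.comp (ProfComp.eta Γ)) w.rangeRestrict
  have hJ : (RingHom.ker Φ).IsPrime := RingHom.ker_isPrime _
  have hJχ : RingHom.ker Φ ≤ (phi χ).asIdeal := fun a ha =>
    evalChar_eq_zero_of_cosetMap_eq_zero (fun _ => 1) (fun γ => (mul_one _).symm) ha
  obtain ⟨Q, hQ, hQJ⟩ := Ideal.exists_minimalPrimes_le (I := PrimeSpectrum.vanishingIdeal S)
    (J := RingHom.ker Φ) hwS
  -- The component containing the coset is `X`, as `χ` lies on no other.
  have hQP : Q = P := by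
    by_contra hQP
    exact hgfχ (Ideal.mul_mem_right _ _ (hJχ (hQJ (hg Q hQ hQP))))
  have hfΦ : Φ f ≠ 0 := fun h => hgfχ (Ideal.mul_mem_left _ _ (hJχ h))
  obtain ⟨ψ, hψ, hψΦ, hψf⟩ := exists_torsion_evalChar_ne_zero _ w.rangeRestrict
    w.rangeRestrict_surjective (fun γ hγ => hw γ (congrArg Subtype.val hγ)) hfΦ
  have hψX : charPoint ψ ∈ X := hXP _ fun a ha => hψΦ a (hQJ (hQP ▸ ha))
  exact hψf ((PrimeSpectrum.mem_vanishingIdeal _ _).1 hf _ ⟨hψX, ψ, hψ, rfl⟩)
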